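/- **Setting.** Constants are numbers or uninterpreted symbols; a ground atom is $p(c_1,\dots,c_k)$ with constants $c_i$. Fix a finite set $B$ of ground atoms (the Herbrand base, e.g. all atoms over a finite language); interpretations are the subsets of $B$. A (ground) standard aggregate atom is $\ell=\mathrm{agg}(s)\ \mathbf{op}\ v$, where $\mathrm{agg}\in\{\mathrm{Sum},\mathrm{Count},\mathrm{Min},\mathrm{Max},\mathrm{Avg}\}$, $\mathbf{op}\in\{=,\neq,<,>,\le,\ge\}$, $v$ is a number, and $s$ is an intensional set $\{X\mid p(t_1,\dots,t_k)\}$ or an intensional multiset $\{\!\{X\mid\exists Z_1,\dots,Z_r.\,p(t_1,\dots,t_k)\}\!\}$ whose arguments $t_i$ are constants or the variables $X$ (resp. $X,Z_1,\dots,Z_r$), all of these variables occurring. In an interpretation $M$, $s$ denotes the set of values of $X$ (resp. the multiset of values of $X$, one occurrence for each substitution of $X,Z_1,\dots,Z_r$) for which $p(t_1,\dots,t_k)$ is in $M$. $M\models\ell$ means that the aggregate of this set or multiset is defined and stands in relation $\mathbf{op}$ to $v$; here $\mathrm{Sum}$, $\mathrm{Min}$, $\mathrm{Max}$, $\mathrm{Avg}$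 are undefined if a non-numeric constant is collected, and for the empty collection $\mathrm{Sum}=\mathrm{Count}=0$, $\mathrm{Min}=+\infty$, $\mathrm{Max}=-\infty$, and $\mathrm{Avg}$ is undefined. Let $\mathcal H(\ell)$ be the set of atoms of $B$ with predicate $p$ and arity $k$; its size is its number of symbol occurrences $(k+1)|\mathcal H(\ell)|$. A pair $\langle I,J\rangle$ of disjoint subsets of $\mathcal H(\ell)$ is an aggregate solution of $\ell$ if $M\models\ell$ for every interpretation $M$ with $I\subseteq M$ and $J\cap M=\emptyset$. Call $\ell$ *admissible* if it is not of the form $\mathrm{Sum}(s)\neq v$ or $\mathrm{Avg}(s)\neq v$. A ground program $P$ over $B$ is a finite list of rules $A\leftarrow C_1,\dots,C_m,A_1,\dots,A_n,\mathrm{not}\,B_1,\dots,\mathrm{not}\,B_q$ with atoms $A,A_i,B_i\in B$ and aggregate atoms $C_i$. For $M\subseteq B$ let $K^P_M(I)$ be the set of heads of the rules of $P$ with no $B_i\in M$, all $A_i\in I$, and $\langle I\cap M\cap\mathcal H(C_i),\ \mathcal H(C_i)\setminus M\rangle$ an aggregate solution of $C_i$ for all $i$. $M$ is an answer set of $P$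 if $M$ is the least fixpoint of $K^P_M$. **Statement.** 1. Let the numbers be real. There are an algorithm with unit-cost real arithmetic and a polynomial $f$ such that, given an admissible aggregate atom $\ell$, the set $\mathcal H(\ell)$ and disjoint $I,J\subseteq\mathcal H(\ell)$, the algorithm decides whether $\langle I,J\rangle$ is an aggregate solution of $\ell$ in at most $f(\mathrm{size}(\mathcal H(\ell)))$ steps. 2. Let the numbers be rational, written in binary. The same problem (given admissible $\ell$, the set $\mathcal H(\ell)$ and disjoint $I,J\subseteq\mathcal H(\ell)$, decide whether $\langle I,J\rangle$ is an aggregate solution of $\ell$) is in $\mathbf P$. 3. With numbers as in 2, for ground programs all of whose aggregate atoms are admissible (given with their finite Herbrand base $B$): deciding, given $P$ and $M\subseteq B$, whether $M$ is an answer set of $P$ is in $\mathbf P$; and deciding, given $P$, whether $P$ has an answer set is in $\mathbf{NP}$. -/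

import Mathlib

namespace AggSol

/-! ### Ground syntax

`K` is the ordered field of numeric constants (`ℚ` or `ℝ`; both contain the integers). Constants are
numbers or uninterpreted symbols. Predicates are identified by a name and an arity. -/

inductive Const (K : Type) where
  | num (x : K)
  | sym (n : ℕ)
  deriving DecidableEq

/-- A ground atom `p(c₁, …, cₙ)`. -/
structure Atom (K : Type) where
  pred : ℕ
  args : List (Const K)
  deriving DecidableEq

/-- An argument of the grouped predicate of a ground aggregate: a constant, or a grouped or local
variable. -/
inductive Term (K : Type) where
  | const (c : Const K)
  | var (i : ℕ)
  deriving DecidableEq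

/-- Intensional sets `{X | p(…)}` or intensional multisets `{{X | ∃ Z₁ … Zᵣ. p(…)}}`. -/
inductive Kind where
  | set
  | multiset
  deriving DecidableEq

/-- A ground intensional set or multiset. The grouped variable occurs among the arguments of the
grouped predicate; the other variables occurring there are the local variables `Z₁, …, Zᵣ`, and an
intensional set has none. -/
structure Intensional (K : Type) where
  kind : Kind
  grouped : ℕ
  pred : ℕ
  args : List (Term K)
  grouped_mem : Term.var grouped ∈ args
  set_no_local : kind = Kind.set → ∀ i, Term.var i ∈ args → i = grouped

inductive AggFn where
  | sum
  | count
  | min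
  | max
  | avg
  deriving DecidableEq

inductive RelOp where
  | eq
  | ne
  | lt
  | gt
  | le
  | ge
  deriving DecidableEq

/-- A ground aggregate atom `fn(s) op v`. -/
structure AggAtom (K : Type) where
  fn : AggFn
  s : Intensional K
  op : RelOp
  v : K

/-- All standard aggregate atoms except `Sum(s) ≠ v` and `Avg(s) ≠ v`. -/
def AggAtom.Tractable {K : Type} (l : AggAtom K) : Prop :=
  (l.fn ≠ AggFn.sum ∧ l.fn ≠ AggFn.avg) ∨ l.op ≠ RelOp.ne

/-- A ground rule `head ← aggs, pos, not neg`. -/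
structure Rule (K : Type) where
  head : Atom K
  aggs : List (AggAtom K)
  pos : List (Atom K)
  neg : List (Atom K)

/-! ### Semantics of aggregate atoms

Interpretations are subsets of a finite Herbrand base, hence finite sets of ground atoms. -/

section Semantics

variable {K : Type}

def Term.inst (γ : ℕ → Const K) : Term K → Const K
  | .const c => c
  | .var i => γ i

/-- The instance of the grouped atom under a ground substitution of its variables. -/
def Intensional.inst (s : Intensional K) (γ : ℕ → Const K) : Atom K :=
  ⟨s.pred, s.args.map (Term.inst γ)⟩

/-- The value that an instance of the grouped atom gives to the grouped variable: the argument at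
a position where that variable occurs. -/
def Intensional.proj [DecidableEq K] (s : Intensional K) (a : Atom K) : Const K :=
  a.args.getD (s.args.idxOf (Term.var s.grouped)) (Const.sym 0)

theorem Intensional.proj_inst [DecidableEq K] (s : Intensional K) (γ : ℕ → Const K) :
    s.proj (s.inst γ) = γ s.grouped := by
  have h : s.args.idxOf (Term.var s.grouped) < s.args.length :=
    List.idxOf_lt_length_iff.2 s.grouped_mem
  have h' : s.args.idxOf (Term.var s.grouped) < (s.args.map (Term.inst γ)).length := by
    simpa using h
  unfold Intensional.proj Intensional.inst
  rw [List.getD_eq_getElem _ _ h', List.getElem_map, List.getElem_idxOf]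
  rfl

open Classical in
/-- The instances of the grouped atom that are true in `M`. Every variable of the intensional
set/multiset occurs in its grouped atom, so these atoms correspond one-to-one to the ground
substitutions of the grouped and local variables that make the grouped atom true in `M`. -/
noncomputable def Intensional.support (s : Intensional K) (M : Finset (Atom K)) :
    Finset (Atom K) :=
  M.filter fun a => ∃ γ : ℕ → Const K, s.inst γ = a

/-- The interpretation of an intensional set/multiset: the set of values of the grouped
variable, respectively the multiset with one occurrence for each substitution. -/
noncomputable def Intensional.interp [DecidableEq K] (s : Intensional K) (M : Finset (Atom K)) :
    Multiset (Const K) :=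
  match s.kind with
  | .set => ((s.support M).image s.proj).val
  | .multiset => (s.support M).val.map s.proj

def Const.num? : Const K → Option K
  | .num x => some x
  | .sym _ => none

variable [Field K] [LinearOrder K]

/-- The value of an aggregate function, in `K` extended by `±∞`. `Count` is defined on all groups;
the others are undefined on groups with a non-numeric member. For the empty group, `Sum` and `Count`
are `0`, `Min` is `+∞`, `Max` is `-∞` and `Avg` is undefined. -/
noncomputable def AggFn.eval (f : AggFn) (g : Multiset (Const K)) :
    Option (WithBot (WithTop K)) :=
  let n : Multiset K := g.filterMap Const.num?
  let value (x : K) : WithBot (WithTop K) := ((x : WithTop K) : WithBot (WithTop K))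
  match f with
  | .count => some (value (Multiset.card g : K))
  | .sum => if ∀ c ∈ g, c.num? ≠ none then some (value n.sum) else none
  | .min => if ∀ c ∈ g, c.num? ≠ none then some (n.map value).inf else none
  | .max => if ∀ c ∈ g, c.num? ≠ none then some (n.map value).sup else none
  | .avg => if (∀ c ∈ g, c.num? ≠ none) ∧ g ≠ 0 then
      some (value (n.sum / (Multiset.card n : K))) else none

def RelOp.Holds {V : Type} [LinearOrder V] : RelOp → V → V → Prop
  | .eq, x, y => x = y
  | .ne, x, y => x ≠ y
  | .lt, x, y => x < y
  | .gt, x, y => y < x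
  | .le, x, y => x ≤ y
  | .ge, x, y => y ≤ x

/-- `M ⊨ l`; an aggregate atom whose aggregate is undefined is not satisfied. -/
def AggAtom.Sat (l : AggAtom K) (M : Finset (Atom K)) : Prop :=
  ∃ y, l.fn.eval (l.s.interp M) = some y ∧
    l.op.Holds y ((l.v : WithTop K) : WithBot (WithTop K))

/-- `H(l)`: the atoms of the Herbrand base `B` built from the grouped predicate of `l`. -/
def AggAtom.ext (l : AggAtom K) (B : Finset (Atom K)) : Finset (Atom K) :=
  B.filter fun a => a.pred = l.s.pred ∧ a.args.length = l.s.args.length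

/-- `⟨S₁, S₂⟩` is an aggregate solution of `l`, over the Herbrand base `B`. -/
def AggAtom.IsSolution (l : AggAtom K) (B S₁ S₂ : Finset (Atom K)) : Prop :=
  S₁ ⊆ l.ext B ∧ S₂ ⊆ l.ext B ∧ Disjoint S₁ S₂ ∧
    ∀ M ⊆ B, S₁ ⊆ M → S₂ ∩ M = ∅ → l.Sat M

/-! ### Fixpoint answer sets -/

/-- Conditional satisfaction `(I, M) ⊨ l`. -/
def AggAtom.CondSat (l : AggAtom K) (B I M : Finset (Atom K)) : Prop :=
  l.IsSolution B (I ∩ M ∩ l.ext B) (l.ext B \ M)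

/-- The reduct of a ground program with respect to `M`. -/
def reduct (P : List (Rule K)) (M : Finset (Atom K)) : List (Rule K) :=
  (P.filter fun r => decide (∀ b ∈ r.neg, b ∉ M)).map fun r => { r with neg := [] }

open Classical in
/-- The consequence operator `K_M^P`. -/
noncomputable def consequence (B : Finset (Atom K)) (P : List (Rule K)) (M I : Finset (Atom K)) :
    Finset (Atom K) :=
  (((reduct P M).filter fun r =>
    decide ((∀ a ∈ r.pos, a ∈ I) ∧ ∀ l ∈ r.aggs, l.CondSat B I M)).map Rule.head).toFinset

/-- `M` is the least fixpoint of `K_M^P` on the interpretations. -/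
def IsAnswerSet (B : Finset (Atom K)) (P : List (Rule K)) (M : Finset (Atom K)) : Prop :=
  IsLeast {I : Finset (Atom K) | I ⊆ B ∧ consequence B P M I = I} M

end Semantics

/-! ### The machine model

Programs of the textbook WHILE language over binary trees, whose leaves are `nil` or numbers. Number
operations are integer literals, `+`, `-`, `*` and `<`. The execution time counts every operation;
an arithmetic operation or comparison is charged in addition the weights of its operands. With weight
`0` this is the unit-cost real-number model. With the bit length as weight this is the
logarithmic-cost model, which is polynomially equivalent to Turing machines: trees are stored with
sharing, so that copying, pairing and taking components are constant-time pointer operations. -/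

inductive Data (K : Type) where
  | nil
  | num (x : K)
  | cons (a b : Data K)

inductive Expr where
  | var (i : ℕ)
  | nil
  | lit (z : ℤ)
  | cons (e f : Expr)
  | hd (e : Expr)
  | tl (e : Expr)
  | isNum (e : Expr)
  | add (e f : Expr)
  | sub (e f : Expr)
  | mul (e f : Expr)
  | lt (e f : Expr)

inductive Cmd where
  | skip
  | assign (i : ℕ) (e : Expr)
  | seq (c d : Cmd)
  | ite (e : Expr) (c d : Cmd)
  | loop (e : Expr) (c : Cmd)

section Machine

variable {K : Type}

abbrev Store (K : Type) := ℕ → Data K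

def Data.hd : Data K → Data K
  | .cons a _ => a
  | _ => .nil

def Data.tl : Data K → Data K
  | .cons _ b => b
  | _ => .nil

/-- Truth values: `nil` is false, everything else is true. -/
def Data.ofBool : Bool → Data K
  | true => .cons .nil .nil
  | false => .nil

def Data.isNum : Data K → Bool
  | .num _ => true
  | _ => false

/-- A binary number operation; the result is `nil` unless both operands are numbers. -/
def Data.op₂ (f : K → K → Data K) : Data K → Data K → Data K
  | .num x, .num y => f x y
  | _, _ => .nil

def Data.weight (w : K → ℕ) : Data K → ℕ
  | .num x => w x
  | _ => 0

def Expr.eval [Ring K] [LinearOrder K] (s : Store K) : Expr → Data K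
  | .var i => s i
  | .nil => .nil
  | .lit z => .num (z : K)
  | .cons e f => .cons (e.eval s) (f.eval s)
  | .hd e => (e.eval s).hd
  | .tl e => (e.eval s).tl
  | .isNum e => .ofBool (e.eval s).isNum
  | .add e f => Data.op₂ (fun x y => .num (x + y)) (e.eval s) (f.eval s)
  | .sub e f => Data.op₂ (fun x y => .num (x - y)) (e.eval s) (f.eval s)
  | .mul e f => Data.op₂ (fun x y => .num (x * y)) (e.eval s) (f.eval s)
  | .lt e f => Data.op₂ (fun x y => .ofBool (decide (x < y))) (e.eval s) (f.eval s)

/-- The time to evaluate an expression. -/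
def Expr.cost [Ring K] [LinearOrder K] (w : K → ℕ) (s : Store K) : Expr → ℕ
  | .var _ => 1
  | .nil => 1
  | .lit _ => 1
  | .cons e f => 1 + e.cost w s + f.cost w s
  | .hd e => 1 + e.cost w s
  | .tl e => 1 + e.cost w s
  | .isNum e => 1 + e.cost w s
  | .add e f | .sub e f | .mul e f | .lt e f =>
      1 + e.cost w s + f.cost w s + (e.eval s).weight w + (f.eval s).weight w

/-- `Exec w c s s' t`: started in store `s`, the command `c` terminates in store `s'` after
time `t`. -/
inductive Exec [Ring K] [LinearOrder K] (w : K → ℕ) : Cmd → Store K → Store K → ℕ → Prop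
  | skip (s : Store K) : Exec w .skip s s 1
  | assign (s : Store K) (i : ℕ) (e : Expr) :
      Exec w (.assign i e) s (Function.update s i (e.eval s)) (1 + e.cost w s)
  | seq {c d : Cmd} {s s₁ s₂ : Store K} {t₁ t₂ : ℕ} :
      Exec w c s s₁ t₁ → Exec w d s₁ s₂ t₂ → Exec w (.seq c d) s s₂ (t₁ + t₂)
  | iteTrue {e : Expr} {c d : Cmd} {s s₁ : Store K} {t : ℕ} :
      e.eval s ≠ .nil → Exec w c s s₁ t → Exec w (.ite e c d) s s₁ (1 + e.cost w s + t)
  | iteFalse {e : Expr} {c d : Cmd} {s s₁ : Store K} {t : ℕ} :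
      e.eval s = .nil → Exec w d s s₁ t → Exec w (.ite e c d) s s₁ (1 + e.cost w s + t)
  | loopTrue {e : Expr} {c : Cmd} {s s₁ s₂ : Store K} {t₁ t₂ : ℕ} :
      e.eval s ≠ .nil → Exec w c s s₁ t₁ → Exec w (.loop e c) s₁ s₂ t₂ →
        Exec w (.loop e c) s s₂ (1 + e.cost w s + t₁ + t₂)
  | loopFalse {e : Expr} {c : Cmd} {s : Store K} :
      e.eval s = .nil → Exec w (.loop e c) s s (1 + e.cost w s)

/-- The input is in variable `0`, all other variables are `nil`. -/
def inputStore (d : Data K) : Store K := fun i => if i = 0 then d else .nil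

/-- On input `d`, the program halts within time `n`, and it accepts (variable `1` is not `nil`) if
and only if `q` holds. -/
def Answers [Ring K] [LinearOrder K] (w : K → ℕ) (c : Cmd) (d : Data K) (n : ℕ) (q : Prop) :
    Prop :=
  ∃ (s : Store K) (t : ℕ), Exec w c (inputStore d) s t ∧ t ≤ n ∧ (s 1 ≠ .nil ↔ q)

/-- One program decides the problem `L` on all instances, in time polynomial in `size`. -/
def PolyTimeDecidable [Ring K] [LinearOrder K] {α : Type} (w : K → ℕ) (enc : α → Data K)
    (size : α → ℕ) (L : α → Prop) : Prop :=
  ∃ (c : Cmd) (p : Polynomial ℕ), ∀ x : α, Answers w c (enc x) (p.eval (size x)) (L x)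

/-- The unit-cost weight. -/
def unitCost (_ : K) : ℕ := 0

/-- The number of bits of a rational number. -/
def bits (x : ℚ) : ℕ := Nat.size x.num.natAbs + Nat.size x.den

/-- The size in bits of an input. -/
def Data.size : Data ℚ → ℕ
  | .nil => 1
  | .num x => 1 + bits x
  | .cons a b => 1 + a.size + b.size

/-- The complexity class P. -/
def InP {α : Type} (enc : α → Data ℚ) (L : α → Prop) : Prop :=
  PolyTimeDecidable bits enc (fun x => (enc x).size) L

/-- The complexity class NP: polynomial-time verification of certificates of polynomial size. -/
def InNP {α : Type} (enc : α → Data ℚ) (L : α → Prop) : Prop :=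
  ∃ (c : Cmd) (p q : Polynomial ℕ) (R : α → Data ℚ → Prop),
    (∀ (x : α) (y : Data ℚ), y.size ≤ q.eval (enc x).size →
      Answers bits c (.cons (enc x) y) (p.eval (enc x).size) (R x y)) ∧
    ∀ x : α, L x ↔ ∃ y : Data ℚ, y.size ≤ q.eval (enc x).size ∧ R x y

end Machine

/-! ### Encodings of the instances as trees -/

section Encodings

variable {K : Type}

def encList {α : Type} (f : α → Data K) (l : List α) : Data K :=
  l.foldr (fun a d => .cons (f a) d) .nil

variable [Field K]

def encNat (n : ℕ) : Data K := .num (n : K)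

def Const.enc : Const K → Data K
  | .num x => .num x
  | .sym n => .cons .nil (encNat n)

def Atom.enc (a : Atom K) : Data K := .cons (encNat a.pred) (encList Const.enc a.args)

def Term.enc : Term K → Data K
  | .var i => .cons .nil (encNat i)
  | .const c => .cons (encNat 1) c.enc

def Kind.enc : Kind → Data K
  | .set => encNat 0
  | .multiset => encNat 1

def Intensional.enc (s : Intensional K) : Data K :=
  .cons s.kind.enc (.cons (encNat s.grouped) (.cons (encNat s.pred) (encList Term.enc s.args)))

def AggFn.enc : AggFn → Data K
  | .sum => encNat 0
  | .count => encNat 1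
  | .min => encNat 2
  | .max => encNat 3
  | .avg => encNat 4

def RelOp.enc : RelOp → Data K
  | .eq => encNat 0
  | .ne => encNat 1
  | .lt => encNat 2
  | .gt => encNat 3
  | .le => encNat 4
  | .ge => encNat 5

def AggAtom.enc (l : AggAtom K) : Data K :=
  .cons l.fn.enc (.cons l.op.enc (.cons (.num l.v) l.s.enc))

def Rule.enc (r : Rule K) : Data K :=
  .cons r.head.enc (.cons (encList AggAtom.enc r.aggs)
    (.cons (encList Atom.enc r.pos) (encList Atom.enc r.neg)))

end Encodings

/-! ### The three decision problems -/

section Problems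

variable {K : Type} [Field K] [LinearOrder K]

/-- An instance of the solution checking problem: an aggregate atom `l` over a finite Herbrand base
`B`, and repetition-free listings of `H(l)` and of two disjoint subsets `I`, `J` of `H(l)`. -/
structure SolutionInstance (K : Type) [Field K] [LinearOrder K] where
  l : AggAtom K
  B : Finset (Atom K)
  H : List (Atom K)
  I : List (Atom K)
  J : List (Atom K)
  H_nodup : H.Nodup
  I_nodup : I.Nodup
  J_nodup : J.Nodup
  H_eq : H.toFinset = l.ext B
  I_sub : I ⊆ H
  J_sub : J ⊆ H
  disj : List.Disjoint I J

/-- The input consists of `l`, `H(l)`, `I` and `J`. -/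
def SolutionInstance.enc (x : SolutionInstance K) : Data K :=
  .cons x.l.enc (.cons (encList Atom.enc x.H)
    (.cons (encList Atom.enc x.I) (encList Atom.enc x.J)))

/-- The size of `H(l)`: its number of symbol occurrences, which is `(k + 1) |H(l)|` if the grouped
predicate has arity `k`. -/
def SolutionInstance.extSize (x : SolutionInstance K) : ℕ :=
  (x.l.s.args.length + 1) * (x.l.ext x.B).card

def SolutionInstance.Yes (x : SolutionInstance K) : Prop :=
  x.l.IsSolution x.B x.I.toFinset x.J.toFinset

/-- A ground program together with its finite Herbrand base. -/
structure Program (K : Type) where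
  base : List (Atom K)
  rules : List (Rule K)
  base_nodup : base.Nodup
  head_mem : ∀ r ∈ rules, r.head ∈ base
  pos_mem : ∀ r ∈ rules, ∀ a ∈ r.pos, a ∈ base
  neg_mem : ∀ r ∈ rules, ∀ a ∈ r.neg, a ∈ base

/-- No aggregate of the form `Sum(s) ≠ v` or `Avg(s) ≠ v` occurs in the program. -/
def Program.Tractable (P : Program K) : Prop :=
  ∀ r ∈ P.rules, ∀ l ∈ r.aggs, l.Tractable

def Program.enc (P : Program K) : Data K :=
  .cons (encList Atom.enc P.base) (encList Rule.enc P.rules)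

/-- An instance of answer set checking: a program and an interpretation `M` of it. -/
structure CheckInstance (K : Type) where
  P : Program K
  M : List (Atom K)
  M_nodup : M.Nodup
  M_sub : M ⊆ P.base

def CheckInstance.enc (x : CheckInstance K) : Data K :=
  .cons x.P.enc (encList Atom.enc x.M)

def CheckInstance.Yes (x : CheckInstance K) : Prop :=
  IsAnswerSet x.P.base.toFinset x.P.rules x.M.toFinset

def Program.HasAnswerSet (P : Program K) : Prop :=
  ∃ M : Finset (Atom K), IsAnswerSet P.base.toFinset P.rules M

end Problems

end AggSol

namespace AggSol

set_option linter.unusedSectionVars false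

/-! ### Polynomial-time functions between types with tree codes -/

/-! Whether `⟨I, J⟩` is an aggregate solution depends on two lists only: the values `D` of the atoms
of `I` that are instances of the grouped atom, and the values `F` of the remaining instances in
`H(l)`, those outside `I` and `J`. As `M` runs over the admitted interpretations, the aggregated
group runs over `D ++ T` for all sublists `T` of `F` (`AggAtom.interp_eq_of_listing`). This includes
intensional sets: without local variables a value determines its atom, so no collapsing occurs
(`Intensional.interp_eq`).

The exponentially many `T` are then replaced by a few extreme ones (`groupCheck_iff`). For Sum,
adding all positive or all negative members of `F` gives the attained maximum and minimum, which
settle every relation except `≠`; the latter would ask about all subset sums in between. Count is a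
sum of ones, and here `≠` is harmless because the counts attained are all integers from `|D|` to
`|D| + |F|`. After subtracting `v`, a statement about Min only asks whether all members are
nonnegative and whether all are positive; Max is the mirror image. On nonempty groups, `Avg op v`
says that the sum of the `x - v` is in relation `op` to `0`.

The operator `K_M^P` is monotone with values inside `B`, so `|B|` iterations from `∅` reach its
least fixpoint (`isLeast_fixpoint_iff`), and each iteration makes polynomially many solution checks.
A certificate for the existence of an answer set is the set itself, given as a selection from `B`.

For the time bounds, `PolyTime` is a class of functions closed under composition, pairing, branching
and bounded folds. The algorithms are ordinary functions built from these operations, so their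
bounds follow structurally by `fun_prop`. One notion serves both machine models: it only needs a
magnitude of numbers that is subadditive under `+` and `-`, and the algorithms only add, subtract
and compare. Over the reals one more point arises: an empty `H(l)` does not bound the length of `l`,
so that case gets its own branch, which does not read the arguments of the grouped atom. -/

theorem eval_mono_nat (p : Polynomial ℕ) {m n : ℕ} (h : m ≤ n) : p.eval m ≤ p.eval n := by
  rw [Polynomial.eval_eq_sum, Polynomial.eval_eq_sum]
  exact Finset.sum_le_sum fun i _ => Nat.mul_le_mul_left _ (Nat.pow_le_pow_left h i)

/-- A weight for number operations together with a subadditive magnitude that controls it. -/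
class CostModel (K : Type) [Field K] [LinearOrder K] where
  weight : K → ℕ
  mag : K → ℕ
  weight_le : ∀ x, weight x ≤ 2 * mag x
  mag_add : ∀ x y, mag (x + y) ≤ mag x + mag y
  mag_sub : ∀ x y, mag (x - y) ≤ mag x + mag y

section Framework

variable {K : Type} [Field K] [LinearOrder K] [CostModel K]

/-- The number of nodes of a tree plus the magnitudes of its numbers. -/
def Data.vol : Data K → ℕ
  | .nil => 1
  | .num x => 1 + CostModel.mag x
  | .cons a b => 1 + a.vol + b.vol

theorem Data.vol_hd_le (d : Data K) : d.hd.vol ≤ d.vol := by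
  cases d <;> simp only [Data.vol, Data.hd] <;> omega

theorem Data.vol_tl_le (d : Data K) : d.tl.vol ≤ d.vol := by
  cases d <;> simp only [Data.vol, Data.tl] <;> omega

theorem Data.weight_le_vol (d : Data K) : d.weight CostModel.weight ≤ 2 * d.vol := by
  cases d with
  | num x => have := CostModel.weight_le x; simp only [Data.vol, Data.weight]; omega
  | _ => simp [Data.weight]

/-- The representation of the elements of `α` by trees over `K`. -/
class TreeCode (K α : Type) where
  code : α → Data K

open TreeCode

instance : TreeCode K Bool := ⟨Data.ofBool⟩
instance : TreeCode K K := ⟨Data.num⟩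
instance : TreeCode K ℕ := ⟨encNat⟩
instance : TreeCode K (Data K) := ⟨id⟩

instance {α : Type} [TreeCode K α] : TreeCode K (List α) := ⟨encList code⟩

instance {α β : Type} [TreeCode K α] [TreeCode K β] : TreeCode K (α × β) :=
  ⟨fun x => .cons (code x.1) (code x.2)⟩

variable {α β γ ε σ : Type} [TreeCode K α] [TreeCode K β] [TreeCode K γ] [TreeCode K ε]
  [TreeCode K σ]

theorem code_pair (x : α × β) : (code x : Data K) = .cons (code x.1) (code x.2) := rfl

theorem code_nil : (code ([] : List α) : Data K) = .nil := rfl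

theorem code_cons (a : α) (l : List α) : (code (a :: l) : Data K) = .cons (code a) (code l) := rfl

theorem code_true : (code true : Data K) = .cons .nil .nil := rfl

theorem code_false : (code false : Data K) = .nil := rfl

theorem code_num (x : K) : (code x : Data K) = .num x := rfl

theorem code_bool_ne_nil (b : Bool) : (code b : Data K) ≠ .nil ↔ b = true := by
  cases b <;> simp [code_true, code_false]

theorem vol_bool_le (b : Bool) : (code b : Data K).vol ≤ 3 := by
  cases b <;> simp [code_true, code_false, Data.vol]

theorem length_le_vol (l : List α) : l.length ≤ (code l : Data K).vol := by
  induction l with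
  | nil => simp
  | cons a l ih => simp only [code_cons, Data.vol, List.length_cons]; omega

theorem vol_le_of_mem {l : List α} {a : α} (h : a ∈ l) :
    (code a : Data K).vol ≤ (code l : Data K).vol := by
  induction l with
  | nil => simp at h
  | cons b l ih =>
    simp only [code_cons, Data.vol]
    rcases List.mem_cons.1 h with rfl | h
    · omega
    · have := ih h; omega

theorem vol_le_of_sublist {l l' : List α} (h : l.Sublist l') :
    (code l : Data K).vol ≤ (code l' : Data K).vol := by
  induction h with
  | slnil => exact le_rfl
  | cons a _ ih => simp only [code_cons, Data.vol]; omega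
  | cons_cons a _ ih => simp only [code_cons, Data.vol]; omega

theorem vol_le_of_forall_le {l : List α} {b : ℕ} (h : ∀ a ∈ l, (code a : Data K).vol ≤ b) :
    (code l : Data K).vol ≤ 1 + l.length * (1 + b) := by
  induction l with
  | nil => simp [code_nil, Data.vol]
  | cons a l ih =>
    have h₁ := h a (by simp)
    have h₂ := ih fun c hc => h c (by simp [hc])
    simp only [code_cons, Data.vol, List.length_cons]
    nlinarith

/-- Started in `s`, the program `c` leaves `d` in register `n` within time `b`, without changing
the registers below `n`. -/
def Runs (c : Cmd) (n : ℕ) (s : Store K) (d : Data K) (b : ℕ) : Prop :=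
  ∃ (s' : Store K) (t : ℕ), Exec CostModel.weight c s s' t ∧ s' n = d ∧
    (∀ m < n, s' m = s m) ∧ t ≤ b

/-- `f` is computed in polynomial time with outputs of polynomial size. For every register `n`
there is a program that reads its argument from `n`, leaves its result there, and uses only
registers from `n` on. -/
@[fun_prop]
def PolyTime (K : Type) [Field K] [LinearOrder K] [CostModel K] {α β : Type} [TreeCode K α]
    [TreeCode K β] (f : α → β) : Prop :=
  ∃ p : Polynomial ℕ,
    (∀ x, (code (f x) : Data K).vol ≤ p.eval (code x : Data K).vol) ∧
    ∀ n, ∃ c : Cmd, ∀ (s : Store K) (x : α), s n = code x →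
      Runs c n s (code (f x)) (p.eval (code x : Data K).vol)

/-- The subtree reached by descending to the first (`false`) or second (`true`) component. -/
def Data.path (d : Data K) : List Bool → Data K
  | [] => d
  | b :: π => Data.path (if b then d.tl else d.hd) π

def Expr.path (e : Expr) : List Bool → Expr
  | [] => e
  | b :: π => Expr.path (if b then .tl e else .hd e) π

theorem Expr.eval_path (s : Store K) (e : Expr) (π : List Bool) :
    (e.path π).eval s = (e.eval s).path π := by
  induction π generalizing e with
  | nil => rfl
  | cons b π ih => cases b <;> simp [Expr.path, Data.path, ih, Expr.eval]

theorem Expr.cost_path (w : K → ℕ) (s : Store K) (e : Expr) (π : List Bool) :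
    (e.path π).cost w s = e.cost w s + π.length := by
  induction π generalizing e with
  | nil => rfl
  | cons b π ih => cases b <;> simp [Expr.path, ih, Expr.cost] <;> omega

theorem Data.vol_path_le (d : Data K) (π : List Bool) : (d.path π).vol ≤ d.vol := by
  induction π generalizing d with
  | nil => exact le_rfl
  | cons b π ih =>
    cases b
    · exact (ih _).trans d.vol_hd_le
    · exact (ih _).trans d.vol_tl_le

/-! ### Closure of polynomial time under composition, pairing, branching and iteration -/

namespace PolyTime

theorem of_expr {f : α → β} (e : ℕ → Expr) (p : Polynomial ℕ)
    (hv : ∀ x, (code (f x) : Data K).vol ≤ p.eval (code x : Data K).vol)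
    (he : ∀ n (s : Store K) x, s n = code x → (e n).eval s = code (f x) ∧
      (e n).cost CostModel.weight s ≤ p.eval (code x : Data K).vol) : PolyTime K f := by
  refine ⟨p + 1, fun x => ?_, fun n => ⟨.assign n (e n), fun s x hs => ?_⟩⟩
  · have := hv x
    simp only [Polynomial.eval_add, Polynomial.eval_one]; omega
  · obtain ⟨h₁, h₂⟩ := he n s x hs
    refine ⟨_, _, Exec.assign s n (e n), by simp [h₁], fun m hm => ?_, ?_⟩
    · simp [Function.update_of_ne hm.ne]
    · simp only [Polynomial.eval_add, Polynomial.eval_one]; omega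

theorem of_path {f : α → β} (π : List Bool)
    (h : ∀ x, (code (f x) : Data K) = (code x : Data K).path π) : PolyTime K f := by
  refine of_expr (fun n => (Expr.var n).path π) (Polynomial.X + Polynomial.C (1 + π.length))
    (fun x => ?_) fun n s x hs => ⟨?_, ?_⟩
  · have := Data.vol_path_le (code x : Data K) π
    rw [h]; simp only [Polynomial.eval_add, Polynomial.eval_X, Polynomial.eval_C]; omega
  · rw [Expr.eval_path, h, ← hs]; rfl
  · rw [Expr.cost_path]
    simp only [Expr.cost, Polynomial.eval_add, Polynomial.eval_X, Polynomial.eval_C]; omega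

theorem of_code_eq {f : α → β} (h : ∀ x, (code (f x) : Data K) = code x) : PolyTime K f :=
  of_path [] h

@[fun_prop]
theorem id : PolyTime K (fun x : α => x) := of_code_eq fun _ => rfl

-- The time for `g` is polynomial in the size of `f x`, not of `x`. This is why `PolyTime` bounds
-- the size of the output as well as the time.
@[fun_prop]
theorem comp {g : β → γ} {f : α → β} (hg : PolyTime K g) (hf : PolyTime K f) :
    PolyTime K (fun x => g (f x)) := by
  obtain ⟨p, hp, hc⟩ := hf
  obtain ⟨q, hq, hd⟩ := hg
  refine ⟨p + q.comp p, fun x => ?_, fun n => ?_⟩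
  · have := (hq (f x)).trans (eval_mono_nat q (hp x))
    simp only [Polynomial.eval_add, Polynomial.eval_comp]; omega
  · obtain ⟨c, hc⟩ := hc n
    obtain ⟨d, hd⟩ := hd n
    refine ⟨.seq c d, fun s x hs => ?_⟩
    obtain ⟨s₁, t₁, e₁, r₁, k₁, b₁⟩ := hc s x hs
    obtain ⟨s₂, t₂, e₂, r₂, k₂, b₂⟩ := hd s₁ (f x) r₁
    refine ⟨s₂, _, .seq e₁ e₂, r₂, fun m hm => (k₂ m hm).trans (k₁ m hm), ?_⟩
    have := eval_mono_nat q (hp x)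
    simp only [Polynomial.eval_add, Polynomial.eval_comp]; omega

@[fun_prop]
theorem pair {f : α → β} {g : α → γ} (hf : PolyTime K f) (hg : PolyTime K g) :
    PolyTime K (fun x => (f x, g x)) := by
  obtain ⟨p, hp, hc⟩ := hf
  obtain ⟨q, hq, hd⟩ := hg
  refine ⟨p + q + 8, fun x => ?_, fun n => ?_⟩
  · have h₁ := hp x
    have h₂ := hq x
    simp only [code_pair, Data.vol, Polynomial.eval_add, Polynomial.eval_ofNat]; omega
  · obtain ⟨c, hc⟩ := hc (n + 1)
    obtain ⟨d, hd⟩ := hd (n + 2)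
    -- Register `n` keeps the argument while `f` is computed from `n + 1` on and `g` from `n + 2`
    -- on, so neither run destroys what is still needed.
    refine ⟨.seq (.assign (n + 1) (.var n)) (.seq c (.seq (.assign (n + 2) (.var n)) (.seq d
      (.assign n (.cons (.var (n + 1)) (.var (n + 2))))))), fun s x hs => ?_⟩
    obtain ⟨s₁, t₁, e₁, r₁, k₁, b₁⟩ := hc (Function.update s (n + 1) (s n)) x (by simp [hs])
    obtain ⟨s₂, t₂, e₂, r₂, k₂, b₂⟩ := hd (Function.update s₁ (n + 2) (s₁ n)) x (by
      simp [k₁ n (by omega), hs])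
    refine ⟨_, _, .seq (.assign ..) (.seq e₁ (.seq (.assign ..) (.seq e₂ (.assign ..)))), ?_,
      fun m hm => ?_, ?_⟩
    · simp [Expr.eval, r₂, k₂ (n + 1) (by omega), r₁, code_pair]
    · rw [Function.update_of_ne (by omega), k₂ m (by omega), Function.update_of_ne (by omega),
        k₁ m (by omega), Function.update_of_ne (by omega)]
    · simp only [Expr.cost, Polynomial.eval_add, Polynomial.eval_ofNat]; omega

theorem fst' : PolyTime K (Prod.fst : α × β → α) := of_path [false] fun _ => rfl

theorem snd' : PolyTime K (Prod.snd : α × β → β) := of_path [true] fun _ => rfl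

@[fun_prop]
theorem fst {f : α → β × γ} (hf : PolyTime K f) : PolyTime K (fun x => (f x).1) := fst'.comp hf

@[fun_prop]
theorem snd {f : α → β × γ} (hf : PolyTime K f) : PolyTime K (fun x => (f x).2) := snd'.comp hf

@[fun_prop]
theorem cond {c : α → Bool} {f g : α → β} (hc : PolyTime K c) (hf : PolyTime K f)
    (hg : PolyTime K g) : PolyTime K (fun x => bif c x then f x else g x) := by
  obtain ⟨r, -, hr⟩ := hc
  obtain ⟨p, hp, hc⟩ := hf
  obtain ⟨q, hq, hd⟩ := hg
  refine ⟨r + p + q + 8, fun x => ?_, fun n => ?_⟩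
  · have h₁ := hp x
    have h₂ := hq x
    simp only [Polynomial.eval_add, Polynomial.eval_ofNat]
    cases c x <;> simp only [cond_true, cond_false] <;> omega
  · obtain ⟨b, hb⟩ := hr (n + 1)
    obtain ⟨c₁, hc⟩ := hc n
    obtain ⟨d, hd⟩ := hd n
    refine ⟨.seq (.assign (n + 1) (.var n)) (.seq b (.ite (.var (n + 1)) c₁ d)), fun s x hs => ?_⟩
    obtain ⟨s₁, t₁, e₁, r₁, k₁, b₁⟩ := hb (Function.update s (n + 1) (s n)) x (by simp [hs])
    have hn : s₁ n = code x := by simp [k₁ n (by omega), hs]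
    have hk : ∀ m < n, s₁ m = s m := fun m hm => by
      rw [k₁ m (by omega), Function.update_of_ne (by omega)]
    cases h : c x
    · obtain ⟨s₂, t₂, e₂, r₂, k₂, b₂⟩ := hd s₁ x hn
      refine ⟨s₂, _, .seq (.assign ..) (.seq e₁ (.iteFalse ?_ e₂)), by simpa [h] using r₂,
        fun m hm => (k₂ m hm).trans (hk m hm), ?_⟩
      · rw [Expr.eval, r₁, h]; rfl
      · simp only [Expr.cost, Polynomial.eval_add, Polynomial.eval_ofNat]; omega
    · obtain ⟨s₂, t₂, e₂, r₂, k₂, b₂⟩ := hc s₁ x hn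
      refine ⟨s₂, _, .seq (.assign ..) (.seq e₁ (.iteTrue ?_ e₂)), by simpa [h] using r₂,
        fun m hm => (k₂ m hm).trans (hk m hm), ?_⟩
      · rw [Expr.eval, r₁, h]; simp [code_true]
      · simp only [Expr.cost, Polynomial.eval_add, Polynomial.eval_ofNat]; omega

/-- Iteration over a list, when the intermediate results stay polynomially bounded. -/
theorem foldl_of_bound {L : ε → List α} {init : ε → σ} {step : ε → σ → α → σ}
    (hL : PolyTime K L) (hi : PolyTime K init)
    (hs : PolyTime K fun y : ε × σ × α => step y.1 y.2.1 y.2.2) (q : Polynomial ℕ)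
    (hq : ∀ x l, l <+: L x →
      (code (l.foldl (step x) (init x)) : Data K).vol ≤ q.eval (code x : Data K).vol) :
    PolyTime K (fun x => (L x).foldl (step x) (init x)) := by
  obtain ⟨pL, hpL, hcL⟩ := hL
  obtain ⟨pI, hpI, hcI⟩ := hi
  obtain ⟨pS, hpS, hcS⟩ := hs
  -- A step reads a triple of the input, the state and a list member; its volume is at most `2` plus
  -- the bounds `X`, `q` and `pL` for the three. There are at most `pL` steps, and the constants pay
  -- for the register moves.
  refine ⟨q + pL + pI + pL * (pS.comp (2 + Polynomial.X + q + pL) + 20) + 20, fun x => ?_,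
    fun n => ?_⟩
  · have := hq x _ (List.prefix_refl _)
    simp only [Polynomial.eval_add, Polynomial.eval_ofNat]; omega
  obtain ⟨cL, hcL⟩ := hcL (n + 1)
  obtain ⟨cI, hcI⟩ := hcI (n + 2)
  obtain ⟨cS, hcS⟩ := hcS (n + 3)
  -- Register `n` holds the input, `n + 1` the unprocessed rest of the list, `n + 2` the state; the
  -- step works from `n + 3` on.
  set body : Cmd := .seq (.assign (n + 3) (.cons (.var n) (.cons (.var (n + 2))
    (.hd (.var (n + 1)))))) (.seq cS (.seq (.assign (n + 2) (.var (n + 3)))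
      (.assign (n + 1) (.tl (.var (n + 1)))))) with hbody
  -- Loop invariant: the state is the fold over the processed prefix `pre`, so `hq` bounds it.
  -- Registers above `n + 2` are arbitrary.
  have key : ∀ (x : ε) (rest pre : List α) (s : Store K), pre ++ rest = L x → s n = code x →
      s (n + 1) = code rest → s (n + 2) = code (pre.foldl (step x) (init x)) →
      ∃ s' t, Exec CostModel.weight (.loop (.var (n + 1)) body) s s' t ∧
        s' (n + 2) = code ((L x).foldl (step x) (init x)) ∧ (∀ m < n, s' m = s m) ∧
        t ≤ rest.length * (pS.eval (2 + (code x : Data K).vol + q.eval (code x : Data K).vol +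
          pL.eval (code x : Data K).vol) + 20) + 2 := by
    intro x rest
    induction rest with
    | nil =>
      intro pre s h hn h₁ h₂
      refine ⟨s, _, .loopFalse ?_, ?_, fun _ _ => rfl, ?_⟩
      · rw [Expr.eval, h₁]; rfl
      · rw [h₂, ← h, List.append_nil]
      · simp [Expr.cost]
    | cons a rest ih =>
      intro pre s h hn h₁ h₂
      set st := pre.foldl (step x) (init x) with hst
      obtain ⟨s₁, t₁, e₁, r₁, k₁, b₁⟩ := hcS (Function.update s (n + 3)
        (.cons (code x) (.cons (code st) (code a)))) (x, st, a) (by simp [code_pair])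
      have hb : pS.eval (code (x, st, a) : Data K).vol ≤ pS.eval (2 + (code x : Data K).vol +
          q.eval (code x : Data K).vol + pL.eval (code x : Data K).vol) := by
        apply eval_mono_nat
        have g₁ := hq x pre ⟨a :: rest, h⟩
        have g₂ : (code a : Data K).vol ≤ _ :=
          (vol_le_of_mem (l := L x) (by rw [← h]; simp)).trans (hpL x)
        simp only [code_pair, Data.vol]
        simp only [← hst] at g₁
        omega
      obtain ⟨s₂, t₂, e₂, r₂, k₂, b₂⟩ := ih (pre ++ [a])
        (Function.update (Function.update s₁ (n + 2) (code (step x st a))) (n + 1) (code rest))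
        (by simp [h])
        (by
          rw [Function.update_of_ne (by omega), Function.update_of_ne (by omega), k₁ n (by omega),
            Function.update_of_ne (by omega), hn])
        (by simp)
        (by rw [Function.update_of_ne (by omega)]; simp [hst])
      have x₁ := Exec.assign (K := K) (w := CostModel.weight) s (n + 3)
        (.cons (.var n) (.cons (.var (n + 2)) (.hd (.var (n + 1)))))
      have x₂ := Exec.assign (K := K) (w := CostModel.weight) s₁ (n + 2) (.var (n + 3))
      have x₃ := Exec.assign (K := K) (w := CostModel.weight)
        (Function.update s₁ (n + 2) (code (step x st a))) (n + 1) (.tl (.var (n + 1)))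
      have v₁ : Expr.eval s (.cons (.var n) (.cons (.var (n + 2)) (.hd (.var (n + 1))))) =
          .cons (code x) (.cons (code st) (code a)) := by
        simp only [Expr.eval, hn, h₁, h₂, code_cons, Data.hd]
      have v₂ : Expr.eval s₁ (.var (n + 3)) = code (step x st a) := r₁
      have v₃ : Expr.eval (Function.update s₁ (n + 2) (code (step x st a))) (.tl (.var (n + 1))) =
          code rest := by
        rw [Expr.eval, Expr.eval, Function.update_of_ne (by omega), k₁ (n + 1) (by omega),
          Function.update_of_ne (by omega), h₁]
        rfl
      rw [v₁] at x₁
      rw [v₂] at x₂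
      rw [v₃] at x₃
      refine ⟨s₂, _, .loopTrue ?_ (.seq x₁ (.seq e₁ (.seq x₂ x₃))) e₂, r₂, fun m hm => ?_, ?_⟩
      · rw [Expr.eval, h₁]; simp [code_cons]
      · rw [k₂ m hm, Function.update_of_ne (by omega), Function.update_of_ne (by omega),
          k₁ m (by omega), Function.update_of_ne (by omega)]
      · simp only [Expr.cost, List.length_cons]
        rw [Nat.add_mul]
        omega
  refine ⟨.seq (.assign (n + 1) (.var n)) (.seq cL (.seq (.assign (n + 2) (.var n)) (.seq cI
    (.seq (.loop (.var (n + 1)) body) (.assign n (.var (n + 2))))))), fun s x hs => ?_⟩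
  obtain ⟨s₁, t₁, e₁, r₁, k₁, b₁⟩ := hcL (Function.update s (n + 1) (s n)) x (by simp [hs])
  have hn₁ : s₁ n = code x := by simp [k₁ n (by omega), hs]
  obtain ⟨s₂, t₂, e₂, r₂, k₂, b₂⟩ := hcI (Function.update s₁ (n + 2) (s₁ n)) x (by simp [hn₁])
  obtain ⟨s₃, t₃, e₃, r₃, k₃, b₃⟩ := key x (L x) [] s₂ rfl
    (by rw [k₂ n (by omega), Function.update_of_ne (by omega), hn₁])
    (by rw [k₂ (n + 1) (by omega), Function.update_of_ne (by omega), r₁]) r₂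
  refine ⟨_, _, .seq (.assign ..) (.seq e₁ (.seq (.assign ..) (.seq e₂ (.seq e₃ (.assign ..))))),
    ?_, fun m hm => ?_, ?_⟩
  · simp [Expr.eval, r₃]
  · rw [Function.update_of_ne (by omega), k₃ m hm, k₂ m (by omega),
      Function.update_of_ne (by omega), k₁ m (by omega), Function.update_of_ne (by omega)]
  · have hlen := (length_le_vol (K := K) (L x)).trans (hpL x)
    have := Nat.mul_le_mul_right (pS.eval (2 + (code x : Data K).vol +
      q.eval (code x : Data K).vol + pL.eval (code x : Data K).vol) + 20) hlen
    simp only [Expr.cost, Polynomial.eval_add, Polynomial.eval_ofNat, Polynomial.eval_mul,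
      Polynomial.eval_comp, Polynomial.eval_X]
    omega

/-- Iteration over a list, when each step increases the state by a polynomially bounded amount. -/
theorem foldl_of_growth {L : ε → List α} {init : ε → σ} {step : ε → σ → α → σ}
    (hL : PolyTime K L) (hi : PolyTime K init)
    (hs : PolyTime K fun y : ε × σ × α => step y.1 y.2.1 y.2.2) (r : Polynomial ℕ)
    (hr : ∀ x s, ∀ a ∈ L x, (code (step x s a) : Data K).vol ≤
      (code s : Data K).vol + r.eval (code x : Data K).vol) :
    PolyTime K (fun x => (L x).foldl (step x) (init x)) := by
  have ⟨pL, hpL, _⟩ := hL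
  have ⟨pI, hpI, _⟩ := hi
  refine foldl_of_bound hL hi hs (pI + pL * r) fun x l hl => ?_
  have h : ∀ (l : List α) (s : σ), l ⊆ L x → (code (l.foldl (step x) s) : Data K).vol ≤
      (code s : Data K).vol + l.length * r.eval (code x : Data K).vol := by
    intro l
    induction l with
    | nil => intro s _; simp
    | cons a l ih =>
      intro s hl
      have h₁ := ih (step x s a) fun b hb => hl (by simp [hb])
      have h₂ := hr x s a (hl (by simp))
      rw [List.foldl_cons, List.length_cons, Nat.add_mul]
      omega
  have h₁ := h l (init x) hl.subset
  have h₂ := Nat.mul_le_mul_right (r.eval (code x : Data K).vol)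
    (hl.length_le.trans ((length_le_vol (K := K) (L x)).trans (hpL x)))
  have h₃ := hpI x
  simp only [Polynomial.eval_add, Polynomial.eval_mul]
  omega

end PolyTime

end Framework

/-! ### Constants, Boolean operations, arithmetic and list operations in polynomial time -/

section Combinators

open TreeCode

variable {K : Type} [Field K] [LinearOrder K] [CostModel K]
variable {α β γ ε σ : Type} [TreeCode K α] [TreeCode K β] [TreeCode K γ] [TreeCode K ε]
  [TreeCode K σ]

/-- Constants that can be written down in a program. -/
class Literal (K : Type) [Field K] [LinearOrder K] [CostModel K] {β : Type} [TreeCode K β]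
    (b : β) : Prop where
  exists_expr : ∃ (e : Expr) (k : ℕ), ∀ s : Store K,
    e.eval s = code b ∧ e.cost CostModel.weight s ≤ k

instance (b : Bool) : Literal K b := by
  cases b
  · exact ⟨.nil, 1, fun s => ⟨rfl, le_rfl⟩⟩
  · exact ⟨.cons .nil .nil, 3, fun s => ⟨rfl, le_rfl⟩⟩

instance (n : ℕ) : Literal K n := ⟨.lit n, 1, fun s => ⟨by
  show Data.num _ = Data.num _
  simp, le_rfl⟩⟩

instance : Literal K (0 : K) := ⟨.lit 0, 1, fun s => ⟨by
  show Data.num _ = Data.num _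
  simp, le_rfl⟩⟩

instance : Literal K (1 : K) := ⟨.lit 1, 1, fun s => ⟨by
  show Data.num _ = Data.num _
  simp, le_rfl⟩⟩

instance : Literal K ([] : List α) := ⟨.nil, 1, fun _ => ⟨rfl, le_rfl⟩⟩

/-- Whether a tree is different from `nil`. -/
def Data.truthy : Data K → Bool
  | .nil => false
  | _ => true

theorem Data.truthy_iff (d : Data K) : d.truthy = true ↔ d ≠ .nil := by
  cases d <;> simp [Data.truthy]

namespace PolyTime

@[fun_prop]
theorem const (b : β) [h : Literal K b] : PolyTime K (fun _ : α => b) := by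
  obtain ⟨e, k, h⟩ := h
  refine of_expr (fun _ => e) (Polynomial.C (k + (code b : Data K).vol)) (fun x => ?_)
    fun n s x _ => ⟨(h s).1, ?_⟩
  · simp
  · have := (h s).2
    simp only [Polynomial.eval_C]; omega

theorem code' : PolyTime K (fun a : α => (code a : Data K)) := of_code_eq fun _ => rfl

theorem truthy' : PolyTime K (Data.truthy (K := K)) := by
  refine ⟨10, fun x => ?_, fun n => ⟨.ite (.var n) (.assign n (.cons .nil .nil)) (.assign n .nil),
    fun s x hs => ?_⟩⟩
  · have := vol_bool_le (K := K) x.truthy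
    simp only [Polynomial.eval_ofNat]; omega
  · cases h : x.truthy
    · have : x = .nil := by cases x <;> simp_all [Data.truthy]
      refine ⟨_, _, .iteFalse (by rw [Expr.eval, hs, this]; rfl) (.assign ..), by
        simp [Expr.eval, code_false], fun m hm => ?_, ?_⟩
      · rw [Function.update_of_ne (by omega)]
      · simp [Expr.cost]
    · refine ⟨_, _, .iteTrue (by rw [Expr.eval, hs]; exact (Data.truthy_iff x).1 h)
        (.assign ..), by simp [Expr.eval, code_true], fun m hm => ?_, ?_⟩
      · rw [Function.update_of_ne (by omega)]
      · simp [Expr.cost]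

@[fun_prop]
theorem truthy {f : α → Data K} (hf : PolyTime K f) : PolyTime K (fun x => (f x).truthy) :=
  truthy'.comp hf

@[fun_prop]
theorem hd {f : α → Data K} (hf : PolyTime K f) : PolyTime K (fun x => (f x).hd) :=
  comp (of_path (f := Data.hd) [false] fun _ => rfl) hf

@[fun_prop]
theorem tl {f : α → Data K} (hf : PolyTime K f) : PolyTime K (fun x => (f x).tl) :=
  comp (of_path (f := Data.tl) [true] fun _ => rfl) hf

@[fun_prop]
theorem not {f : α → Bool} (hf : PolyTime K f) : PolyTime K (fun x => !f x) := by
  have : (fun x => !f x) = fun x => bif f x then false else true := by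
    funext x; cases f x <;> rfl
  rw [this]; fun_prop

@[fun_prop]
theorem and {f g : α → Bool} (hf : PolyTime K f) (hg : PolyTime K g) :
    PolyTime K (fun x => f x && g x) := by
  have : (fun x => f x && g x) = fun x => bif f x then g x else false := by
    funext x; cases f x <;> rfl
  rw [this]; fun_prop

@[fun_prop]
theorem or {f g : α → Bool} (hf : PolyTime K f) (hg : PolyTime K g) :
    PolyTime K (fun x => f x || g x) := by
  have : (fun x => f x || g x) = fun x => bif f x then true else g x := by
    funext x; cases f x <;> rfl
  rw [this]; fun_prop

/-! Arithmetic -/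

theorem op₂' {g : K → K → β} (e : Expr → Expr → Expr)
    (he : ∀ (s : Store K) e₁ e₂ x y, e₁.eval s = .num x → e₂.eval s = .num y →
      (e e₁ e₂).eval s = code (g x y))
    (hc : ∀ (w : K → ℕ) (s : Store K) e₁ e₂, (e e₁ e₂).cost w s =
      1 + e₁.cost w s + e₂.cost w s + (e₁.eval s).weight w + (e₂.eval s).weight w)
    (hv : ∀ x y, (code (g x y) : Data K).vol ≤ 3 + CostModel.mag x + CostModel.mag y) :
    PolyTime K (fun z : K × K => g z.1 z.2) := by
  refine of_expr (fun n => e (.hd (.var n)) (.tl (.var n))) (4 * Polynomial.X + 5) (fun z => ?_)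
    fun n s z hs => ⟨?_, ?_⟩
  · have := hv z.1 z.2
    simp only [code_pair, Data.vol, code_num, Polynomial.eval_add, Polynomial.eval_mul,
      Polynomial.eval_ofNat, Polynomial.eval_X]
    omega
  · apply he <;> simp only [Expr.eval, hs] <;> rfl
  · rw [hc]
    have h₁ := Data.weight_le_vol (K := K) (.num z.1)
    have h₂ := Data.weight_le_vol (K := K) (.num z.2)
    simp only [Expr.cost, Expr.eval, hs, code_pair, Data.vol, code_num, Data.hd, Data.tl,
      Polynomial.eval_add, Polynomial.eval_mul, Polynomial.eval_ofNat,
      Polynomial.eval_X] at h₁ h₂ ⊢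
    omega

@[fun_prop]
theorem add {f g : α → K} (hf : PolyTime K f) (hg : PolyTime K g) :
    PolyTime K (fun x => f x + g x) := by
  refine comp (g := fun z : K × K => z.1 + z.2) (op₂' (g := fun x y => x + y) .add ?_ ?_ ?_)
    (pair hf hg)
  · intro s e₁ e₂ x y h₁ h₂; simp only [Expr.eval, h₁, h₂]; rfl
  · intro w s e₁ e₂; rfl
  · intro x y; have := CostModel.mag_add x y; simp only [code_num, Data.vol]; omega

@[fun_prop]
theorem sub {f g : α → K} (hf : PolyTime K f) (hg : PolyTime K g) :
    PolyTime K (fun x => f x - g x) := by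
  refine comp (g := fun z : K × K => z.1 - z.2) (op₂' (g := fun x y => x - y) .sub ?_ ?_ ?_)
    (pair hf hg)
  · intro s e₁ e₂ x y h₁ h₂; simp only [Expr.eval, h₁, h₂]; rfl
  · intro w s e₁ e₂; rfl
  · intro x y; have := CostModel.mag_sub x y; simp only [code_num, Data.vol]; omega

@[fun_prop]
theorem decide_lt {f g : α → K} (hf : PolyTime K f) (hg : PolyTime K g) :
    PolyTime K (fun x => decide (f x < g x)) := by
  refine comp (g := fun z : K × K => decide (z.1 < z.2))
    (op₂' (g := fun x y => decide (x < y)) .lt ?_ ?_ ?_) (pair hf hg)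
  · intro s e₁ e₂ x y h₁ h₂; simp only [Expr.eval, h₁, h₂]; rfl
  · intro w s e₁ e₂; rfl
  · intro x y; have := vol_bool_le (K := K) (decide (x < y)); omega

@[fun_prop]
theorem decide_le {f g : α → K} (hf : PolyTime K f) (hg : PolyTime K g) :
    PolyTime K (fun x => decide (f x ≤ g x)) := by
  have : (fun x => decide (f x ≤ g x)) = fun x => !decide (g x < f x) := by
    funext x; rw [Bool.eq_iff_iff]; simp
  rw [this]; fun_prop

@[fun_prop]
theorem decide_eq {f g : α → K} (hf : PolyTime K f) (hg : PolyTime K g) :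
    PolyTime K (fun x => decide (f x = g x)) := by
  have : (fun x => decide (f x = g x)) = fun x => decide (f x ≤ g x) && decide (g x ≤ f x) := by
    funext x; rw [Bool.eq_iff_iff]; simp [le_antisymm_iff]
  rw [this]; fun_prop

@[fun_prop]
theorem natCast {f : α → ℕ} (hf : PolyTime K f) : PolyTime K (fun x => (f x : K)) :=
  comp (of_code_eq (f := fun n : ℕ => (n : K)) fun _ => rfl) hf

@[fun_prop]
theorem decide_eq_nat [CharZero K] {f g : α → ℕ} (hf : PolyTime K f) (hg : PolyTime K g) :
    PolyTime K (fun x => decide (f x = g x)) := by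
  have : (fun x => decide (f x = g x)) = fun x => decide ((f x : K) = (g x : K)) := by
    funext x; simp
  rw [this]; fun_prop

/-! Lists -/

@[fun_prop]
theorem cons {f : α → β} {g : α → List β} (hf : PolyTime K f) (hg : PolyTime K g) :
    PolyTime K (fun x => f x :: g x) :=
  comp (of_code_eq (f := fun z : β × List β => z.1 :: z.2) fun _ => rfl) (pair hf hg)

@[fun_prop]
theorem tail {f : α → List β} (hf : PolyTime K f) : PolyTime K (fun x => (f x).tail) :=
  comp (of_path (f := List.tail) [true] fun l => by cases l <;> rfl) hf

@[fun_prop]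
theorem isEmpty {f : α → List β} (hf : PolyTime K f) : PolyTime K (fun x => (f x).isEmpty) := by
  have : (fun x => (f x).isEmpty) = fun x => !(code (f x) : Data K).truthy := by
    funext x; cases f x <;> rfl
  rw [this]
  exact not (truthy (code'.comp hf))

/-- Allows a function to be computed on raw trees, where components can be taken before the
constructor is known. -/
theorem of_data {f : α → β} {d : α → Data K} (hd : PolyTime K d) (h : ∀ x, d x = code (f x)) :
    PolyTime K f := by
  obtain ⟨q, hq, hc⟩ := hd
  refine ⟨q, fun x => ?_, fun n => ?_⟩
  · rw [← h]; exact hq x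
  · obtain ⟨d, hd⟩ := hc n
    exact ⟨d, fun s x hs => by rw [← h]; exact hd s x hs⟩

@[fun_prop]
theorem headD {f : α → List β} {b : α → β} (hf : PolyTime K f) (hb : PolyTime K b) :
    PolyTime K (fun x => (f x).headD (b x)) := by
  refine of_data (cond (truthy (code'.comp hf)) (hd (code'.comp hf)) (code'.comp hb)) fun x => ?_
  cases f x <;> rfl

@[fun_prop]
theorem any {L : ε → List α} {p : ε → α → Bool} (hL : PolyTime K L)
    (hp : PolyTime K fun y : ε × α => p y.1 y.2) : PolyTime K (fun x => (L x).any (p x)) := by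
  have h : ∀ (l : List α) (p : α → Bool) (b : Bool),
      l.foldl (fun b a => b || p a) b = (b || l.any p) := by
    intro l p
    induction l with
    | nil => simp
    | cons a l ih => intro b; simp [ih, Bool.or_assoc]
  have : (fun x => (L x).any (p x)) =
      fun x => (L x).foldl (fun b a => b || p x a) false := by
    funext x; simp [h]
  rw [this]
  refine foldl_of_bound (step := fun x b a => b || p x a) (init := fun _ => false) hL (by fun_prop)
    ?_ 3 fun x l _ => ?_
  · have := hp.comp (f := fun y : ε × Bool × α => (y.1, y.2.2)) (by fun_prop)
    exact or (by fun_prop) this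
  · simpa using vol_bool_le _

@[fun_prop]
theorem all {L : ε → List α} {p : ε → α → Bool} (hL : PolyTime K L)
    (hp : PolyTime K fun y : ε × α => p y.1 y.2) : PolyTime K (fun x => (L x).all (p x)) := by
  have : (fun x => (L x).all (p x)) = fun x => !(L x).any (fun a => !p x a) := by
    funext x; simp [List.all_eq_not_any_not]
  rw [this]
  exact not (any hL (not hp))

@[fun_prop]
theorem reverse {f : α → List β} (hf : PolyTime K f) : PolyTime K (fun x => (f x).reverse) := by
  have : (fun x => (f x).reverse) = fun x => (f x).foldl (fun l a => a :: l) [] := by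
    funext x; simp
  rw [this]
  have ⟨p, hp, _⟩ := hf
  refine foldl_of_growth (step := fun _ l a => a :: l) (init := fun _ => []) hf (by fun_prop)
    (by fun_prop) (p + 1) fun x s a ha => ?_
  have h := (vol_le_of_mem (K := K) ha).trans (hp x)
  simp only [code_cons, Data.vol, Polynomial.eval_add, Polynomial.eval_one]
  omega

theorem foldr_of_growth {L : ε → List α} {init : ε → σ} {step : ε → α → σ → σ}
    (hL : PolyTime K L) (hi : PolyTime K init)
    (hs : PolyTime K fun y : ε × σ × α => step y.1 y.2.2 y.2.1) (r : Polynomial ℕ)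
    (hr : ∀ x s, ∀ a ∈ L x, (code (step x a s) : Data K).vol ≤
      (code s : Data K).vol + r.eval (code x : Data K).vol) :
    PolyTime K (fun x => (L x).foldr (step x) (init x)) := by
  have : (fun x => (L x).foldr (step x) (init x)) =
      fun x => (L x).reverse.foldl (fun s a => step x a s) (init x) := by
    funext x; simp
  rw [this]
  exact foldl_of_growth (step := fun x s a => step x a s) (reverse hL) hi hs r
    fun x s a ha => hr x s a (by simpa using ha)

@[fun_prop]
theorem map {L : ε → List α} {f : ε → α → β} (hL : PolyTime K L)
    (hf : PolyTime K fun y : ε × α => f y.1 y.2) : PolyTime K (fun x => (L x).map (f x)) := by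
  have : (fun x => (L x).map (f x)) = fun x => (L x).foldr (fun a l => f x a :: l) [] := by
    funext x; exact List.map_eq_foldr
  rw [this]
  have ⟨p, hp, _⟩ := hL
  have ⟨q, hq, _⟩ := hf
  refine foldr_of_growth (step := fun x a l => f x a :: l) (init := fun _ => []) hL (by fun_prop)
    ?_ (q.comp (1 + Polynomial.X + p) + 1) fun x s a ha => ?_
  · have := hf.comp (f := fun y : ε × List β × α => (y.1, y.2.2)) (by fun_prop)
    exact cons this (by fun_prop)
  · have h₁ := (vol_le_of_mem (K := K) ha).trans (hp x)
    have h₂ : (code (f x a) : Data K).vol ≤ _ := hq (x, a)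
    have h₃ := eval_mono_nat q (m := (code (x, a) : Data K).vol)
      (n := 1 + (code x : Data K).vol + p.eval (code x : Data K).vol) (by
        simp only [code_pair, Data.vol]; omega)
    simp only [code_cons, Data.vol, Polynomial.eval_add, Polynomial.eval_one, Polynomial.eval_comp,
      Polynomial.eval_X]
    omega

@[fun_prop]
theorem filter {L : ε → List α} {p : ε → α → Bool} (hL : PolyTime K L)
    (hp : PolyTime K fun y : ε × α => p y.1 y.2) : PolyTime K (fun x => (L x).filter (p x)) := by
  have h : ∀ (l : List α) (p : α → Bool), l.filter p =
      l.foldr (fun a l => bif p a then a :: l else l) [] := by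
    intro l p
    induction l with
    | nil => rfl
    | cons a l ih => cases h : p a <;> simp [h, ih]
  simp only [h]
  have ⟨r, hr, _⟩ := hL
  refine foldr_of_growth (step := fun x a l => bif p x a then a :: l else l)
    (init := fun _ => []) hL (by fun_prop) ?_ (r + 1) fun x s a ha => ?_
  · have := hp.comp (f := fun y : ε × List α × α => (y.1, y.2.2)) (by fun_prop)
    exact cond this (by fun_prop) (by fun_prop)
  · have h₁ := (vol_le_of_mem (K := K) ha).trans (hr x)
    simp only [Polynomial.eval_add, Polynomial.eval_one]
    cases p x a
    · simp only [cond_false]; omega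
    · simp only [cond_true, code_cons, Data.vol]; omega

@[fun_prop]
theorem sum {f : α → List K} (hf : PolyTime K f) : PolyTime K (fun x => (f x).sum) := by
  have : (fun x => (f x).sum) = fun x => (f x).foldr (fun a s => a + s) 0 := rfl
  rw [this]
  have ⟨p, hp, _⟩ := hf
  refine foldr_of_growth (step := fun _ a s => a + s) (init := fun _ => 0) hf (by fun_prop)
    (by fun_prop) p fun x s a ha => ?_
  have h := (vol_le_of_mem (K := K) ha).trans (hp x)
  have := CostModel.mag_add a s
  simp only [code_num, Data.vol] at h ⊢
  omega

@[fun_prop]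
theorem natCast_length {f : α → List β} (hf : PolyTime K f) :
    PolyTime K (fun x => ((f x).length : K)) := by
  have : (fun x => ((f x).length : K)) = fun x => ((f x).map fun _ => (1 : K)).sum := by
    funext x; simp
  rw [this]
  exact sum (map hf (by fun_prop))

/-- A fold over the first list consumes the second one and collects the pairs in reverse. The
default `c` only makes `headD` total; the test for emptiness keeps it out of the result. -/
theorem zip_of_default (c : γ) [Literal K c] {f : α → List β} {g : α → List γ}
    (hf : PolyTime K f) (hg : PolyTime K g) : PolyTime K (fun x => (f x).zip (g x)) := by
  let step (s : List γ × List (β × γ)) (a : β) : List γ × List (β × γ) :=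
    bif s.1.isEmpty then s else (s.1.tail, (a, s.1.headD c) :: s.2)
  have h : ∀ (l : List β) (l' : List γ) (acc : List (β × γ)),
      (l.foldl step (l', acc)).2.reverse = acc.reverse ++ l.zip l' := by
    intro l
    induction l with
    | nil => simp
    | cons a l ih =>
      intro l' acc
      cases l' with
      | nil => simpa [step] using ih [] acc
      | cons b l' => exact (ih l' ((a, b) :: acc)).trans (by simp)
  have : (fun x => (f x).zip (g x)) = fun x => ((f x).foldl step (g x, [])).2.reverse := by
    funext x; simp [h]
  rw [this]
  have ⟨p, hp, _⟩ := hf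
  refine reverse (snd (foldl_of_growth (step := fun _ => step) (init := fun x => (g x, [])) hf
    (by fun_prop) (by fun_prop) (p + 1) fun x s a ha => ?_))
  have h := (vol_le_of_mem (K := K) ha).trans (hp x)
  simp only [Polynomial.eval_add, Polynomial.eval_one]
  obtain ⟨l', acc⟩ := s
  cases l' with
  | nil => simp only [step, List.isEmpty_nil, cond_true]; omega
  | cons b l' =>
    simp only [step, List.isEmpty_cons, cond_false, List.tail_cons, List.headD_cons, code_pair,
      code_cons, Data.vol]
    omega

end PolyTime
end Combinators

/-! ### The algorithms -/

section Algorithms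

open TreeCode

variable {K : Type} [Field K] [LinearOrder K]

def Const.isNum : Const K → Bool
  | .num _ => true
  | .sym _ => false

/-- The number in a constant, or the index of a symbol. -/
def Const.val : Const K → K
  | .num x => x
  | .sym n => n

/-- The tags must be compared too, since `sym n` and `num n` have the same `val`. Likewise for
variables and constants in `Term.same`. -/
def Const.same (a b : Const K) : Bool :=
  (bif a.isNum then b.isNum else !b.isNum) && decide (a.val = b.val)

def Term.isVar : Term K → Bool
  | .const _ => false
  | .var _ => true

/-- The constant in a term, or the index of a variable. -/
def Term.toConst : Term K → Const K
  | .const c => c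
  | .var i => .num i

def Term.same (t u : Term K) : Bool :=
  (bif t.isVar then u.isVar else !u.isVar) && t.toConst.same u.toConst

/-- The lengths are compared because `zip` truncates, and as elements of `K` because these are the
numbers of the machine. -/
def sameArgs (cs ds : List (Const K)) : Bool :=
  decide ((cs.length : K) = ds.length) && (cs.zip ds).all fun z => z.1.same z.2

def Atom.same (a b : Atom K) : Bool :=
  decide (a.pred = b.pred) && sameArgs a.args b.args

def memAtom (l : List (Atom K)) (a : Atom K) : Bool := l.any fun b => a.same b

/-- Whether two arguments of an atom fit to two terms of a pattern. -/
def fits (y z : Term K × Const K) : Bool := !y.1.same z.1 || y.2.same z.2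

/-- No substitution is constructed: one exists as soon as constants face themselves and equal terms
face equal constants, which takes quadratically many comparisons. -/
def matchArgs (ts : List (Term K)) (cs : List (Const K)) : Bool :=
  decide ((ts.length : K) = cs.length) && (ts.zip cs).all fun z =>
    (z.1.isVar || z.1.toConst.same z.2) && (ts.zip cs).all fun y => fits z y

/-- Whether an atom is an instance of the grouped atom. -/
def Intensional.matches (s : Intensional K) (a : Atom K) : Bool :=
  decide (a.pred = s.pred) && matchArgs s.args a.args

/-- The value of the grouped variable in an instance of the grouped atom. -/
def Intensional.value (s : Intensional K) (a : Atom K) : Const K :=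
  (((s.args.zip a.args).filter fun z =>
    z.1.isVar && z.1.toConst.same (.num s.grouped)).map fun z => z.2).headD (.num 0)

def RelOp.elim {β : Type} (op : RelOp) (eq ne lt gt le ge : β) : β :=
  match op with
  | .eq => eq
  | .ne => ne
  | .lt => lt
  | .gt => gt
  | .le => le
  | .ge => ge

/-- The relation read from right to left; it reduces Max to Min by reversing the order. -/
def RelOp.flip (op : RelOp) : RelOp := op.elim .eq .ne .gt .lt .ge .le

def AggFn.elim {β : Type} (fn : AggFn) (sum count min max avg : β) : β :=
  match fn with
  | .sum => sum
  | .count => count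
  | .min => min
  | .max => max
  | .avg => avg

/-! ### Tests for the fixed values `D` and the optional values `F` of a group -/

def posSum (l : List K) : K := (l.map fun y => bif decide (0 < y) then y else 0).sum

def negSum (l : List K) : K := (l.map fun y => bif decide (y < 0) then y else 0).sum

/-- Whether the sum of `D` and any part of `F` is in relation `op` to `v`, for `op` other
than `≠`. -/
def sumCheck (op : RelOp) (v : K) (D F : List K) : Bool :=
  op.elim (decide (D.sum + posSum F ≤ v) && decide (v ≤ D.sum + negSum F)) false
    (decide (D.sum + posSum F < v)) (decide (v < D.sum + negSum F))
    (decide (D.sum + posSum F ≤ v)) (decide (v ≤ D.sum + negSum F))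

/-- Whether `x` differs from `0, …, |F|`. -/
def notCount {α : Type} (x : K) (F : List α) : Bool :=
  !decide (F.foldl (fun y _ => bif decide (y = 0) then 0 else y - 1) x = 0)

def allNonneg (l : List K) : Bool := l.all fun x => decide (0 ≤ x)

def allPos (l : List K) : Bool := l.all fun x => decide (0 < x)

/-- Whether the minimum of `D` and any part of `F` is in relation `op` to `0`. -/
def minCheck (op : RelOp) (D F : List K) : Bool :=
  op.elim (allNonneg D && allNonneg F && !allPos D)
    (!(allNonneg D && (!allPos D || F.any fun x => decide (x = 0))))
    (!allNonneg D) (allPos D && allPos F) (!allPos D) (allNonneg D && allNonneg F)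

def numeric (l : List (Const K)) : Bool := l.all fun c => c.isNum

def vals (l : List (Const K)) : List K := l.map fun c => c.val

/-- Whether `fn` of `D` and any part of `F` is defined and in relation `op` to `v`. -/
def groupCheck (fn : AggFn) (op : RelOp) (v : K) (D F : List (Const K)) : Bool :=
  fn.elim
    (numeric D && numeric F && sumCheck op v (vals D) (vals F))
    (op.elim (sumCheck op v (D.map fun _ => 1) (F.map fun _ => 1)) (notCount (v - D.length) F)
      (sumCheck op v (D.map fun _ => 1) (F.map fun _ => 1))
      (sumCheck op v (D.map fun _ => 1) (F.map fun _ => 1))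
      (sumCheck op v (D.map fun _ => 1) (F.map fun _ => 1))
      (sumCheck op v (D.map fun _ => 1) (F.map fun _ => 1)))
    (numeric D && numeric F &&
      minCheck op ((vals D).map fun x => x - v) ((vals F).map fun x => x - v))
    (numeric D && numeric F &&
      minCheck op.flip ((vals D).map fun x => v - x) ((vals F).map fun x => v - x))
    (numeric D && numeric F && !D.isEmpty &&
      sumCheck op 0 ((vals D).map fun x => x - v) ((vals F).map fun x => x - v))

/-! ### From groups to aggregate atoms, rules and answer sets -/

def AggAtom.fixedVals (l : AggAtom K) (I : List (Atom K)) : List (Const K) :=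
  (I.filter fun a => l.s.matches a).map fun a => l.s.value a

def AggAtom.freeVals (l : AggAtom K) (H I J : List (Atom K)) : List (Const K) :=
  (H.filter fun a => l.s.matches a && !memAtom I a && !memAtom J a).map fun a => l.s.value a

/-- Whether `⟨I, J⟩` is an aggregate solution of `l`. -/
def AggAtom.solutionCheck (l : AggAtom K) (H I J : List (Atom K)) : Bool :=
  groupCheck l.fn l.op l.v (l.fixedVals I) (l.freeVals H I J)

def AggAtom.extList (l : AggAtom K) (B : List (Atom K)) : List (Atom K) :=
  B.filter fun a => decide (a.pred = l.s.pred) && decide ((a.args.length : K) = l.s.args.length)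

def AggAtom.condCheck (l : AggAtom K) (B I M : List (Atom K)) : Bool :=
  l.solutionCheck (l.extList B) ((l.extList B).filter fun a => memAtom I a && memAtom M a)
    ((l.extList B).filter fun a => !memAtom M a)

/-- Whether a rule is in the reduct and its body holds. -/
def Rule.fires (r : Rule K) (B M I : List (Atom K)) : Bool :=
  (r.neg.all fun b => !memAtom M b) && (r.pos.all fun a => memAtom I a) &&
    r.aggs.all fun l => l.condCheck B I M

/-- Filtering `B` instead of collecting heads keeps the result a sublist of `B`, so its size stays
bounded under iteration. -/
def consequenceList (B : List (Atom K)) (P : List (Rule K)) (M I : List (Atom K)) :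
    List (Atom K) :=
  B.filter fun a => P.any fun r => r.head.same a && r.fires B M I

/-- Here `B` also serves as the loop counter: one application of the operator per atom suffices. -/
def leastModel (B : List (Atom K)) (P : List (Rule K)) (M : List (Atom K)) : List (Atom K) :=
  B.foldl (fun I _ => consequenceList B P M I) []

def answerSetCheck (B : List (Atom K)) (P : List (Rule K)) (M : List (Atom K)) : Bool :=
  ((leastModel B P M).all fun a => memAtom M a) && M.all fun a => memAtom (leastModel B P M) a

/-- The sublist of `B` selected by the components of a tree that are not `nil`. -/
def selectAtoms (B : List (Atom K)) (y : Data K) : List (Atom K) :=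
  (B.foldl (fun z a => (z.1.tl, bif z.1.hd.truthy then a :: z.2 else z.2))
    (y, ([] : List (Atom K)))).2

/-! ### Their running time -/

variable [CostModel K]

instance : TreeCode K (Const K) := ⟨Const.enc⟩
instance : TreeCode K (Atom K) := ⟨Atom.enc⟩
instance : TreeCode K (Term K) := ⟨Term.enc⟩
instance : TreeCode K (Intensional K) := ⟨Intensional.enc⟩
instance : TreeCode K AggFn := ⟨AggFn.enc⟩
instance : TreeCode K RelOp := ⟨RelOp.enc⟩
instance : TreeCode K (AggAtom K) := ⟨AggAtom.enc⟩
instance : TreeCode K (Rule K) := ⟨Rule.enc⟩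

variable {ε α β γ : Type} [TreeCode K ε] [TreeCode K α] [TreeCode K β] [TreeCode K γ]

namespace PolyTime

@[fun_prop]
theorem constNum {f : ε → K} (hf : PolyTime K f) : PolyTime K (fun x => Const.num (f x)) :=
  comp (of_code_eq (f := fun y : K => Const.num y) fun _ => rfl) hf

instance : Literal K (Const.num 0 : Const K) := ⟨.lit 0, 1, fun s => ⟨by
  show Data.num _ = Data.num _
  simp, le_rfl⟩⟩

@[fun_prop]
theorem constIsNum {f : ε → Const K} (hf : PolyTime K f) : PolyTime K (fun x => (f x).isNum) := by
  refine comp (of_expr (f := Const.isNum) (fun n => .isNum (.var n)) 3 (fun x => ?_)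
    fun n s x hs => ⟨?_, ?_⟩) hf
  · simpa using vol_bool_le _
  · rw [Expr.eval, Expr.eval, hs]; cases x <;> rfl
  · simp [Expr.cost]

@[fun_prop]
theorem constVal {f : ε → Const K} (hf : PolyTime K f) : PolyTime K (fun x => (f x).val) := by
  refine of_data (cond (constIsNum hf) (code'.comp hf) (tl (code'.comp hf))) fun x => ?_
  cases f x <;> rfl

@[fun_prop]
theorem constSame {f g : ε → Const K} (hf : PolyTime K f) (hg : PolyTime K g) :
    PolyTime K (fun x => (f x).same (g x)) := by
  unfold Const.same; fun_prop

-- The code of a variable has `nil` as first component, that of a constant has a number there.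
@[fun_prop]
theorem termIsVar {f : ε → Term K} (hf : PolyTime K f) : PolyTime K (fun x => (f x).isVar) := by
  have : (fun x => (f x).isVar) = fun x => !(code (f x) : Data K).hd.truthy := by
    funext x; cases f x <;> rfl
  rw [this]
  exact not (truthy (hd (code'.comp hf)))

@[fun_prop]
theorem termToConst {f : ε → Term K} (hf : PolyTime K f) : PolyTime K (fun x => (f x).toConst) :=
  comp (of_path (f := Term.toConst) [true] fun t => by cases t <;> rfl) hf

@[fun_prop]
theorem termSame {f g : ε → Term K} (hf : PolyTime K f) (hg : PolyTime K g) :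
    PolyTime K (fun x => (f x).same (g x)) := by
  unfold Term.same; fun_prop

@[fun_prop]
theorem zip {f : ε → List α} {g : ε → List (Const K)} (hf : PolyTime K f) (hg : PolyTime K g) :
    PolyTime K (fun x => (f x).zip (g x)) :=
  zip_of_default (.num 0) hf hg

@[fun_prop]
theorem sameArgs {f g : ε → List (Const K)} (hf : PolyTime K f) (hg : PolyTime K g) :
    PolyTime K (fun x => sameArgs (f x) (g x)) := by
  unfold AggSol.sameArgs; fun_prop

@[fun_prop]
theorem atomPred {f : ε → Atom K} (hf : PolyTime K f) : PolyTime K (fun x => (f x).pred) :=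
  comp (of_path (f := Atom.pred) [false] fun _ => rfl) hf

@[fun_prop]
theorem atomArgs {f : ε → Atom K} (hf : PolyTime K f) : PolyTime K (fun x => (f x).args) :=
  comp (of_path (f := Atom.args) [true] fun _ => rfl) hf

variable [CharZero K]

@[fun_prop]
theorem atomSame {f g : ε → Atom K} (hf : PolyTime K f) (hg : PolyTime K g) :
    PolyTime K (fun x => (f x).same (g x)) := by
  unfold Atom.same; fun_prop

@[fun_prop]
theorem memAtom {f : ε → List (Atom K)} {g : ε → Atom K} (hf : PolyTime K f)
    (hg : PolyTime K g) : PolyTime K (fun x => memAtom (f x) (g x)) := by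
  unfold AggSol.memAtom; fun_prop

@[fun_prop]
theorem fits {f g : ε → Term K × Const K} (hf : PolyTime K f)
    (hg : PolyTime K g) : PolyTime K (fun x => fits (f x) (g x)) := by
  unfold AggSol.fits; fun_prop

@[fun_prop]
theorem matchArgs {f : ε → List (Term K)} {g : ε → List (Const K)} (hf : PolyTime K f)
    (hg : PolyTime K g) : PolyTime K (fun x => matchArgs (f x) (g x)) := by
  unfold AggSol.matchArgs; fun_prop

@[fun_prop]
theorem intensionalGrouped {f : ε → Intensional K} (hf : PolyTime K f) :
    PolyTime K (fun x => (f x).grouped) :=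
  comp (of_path (f := Intensional.grouped) [true, false] fun _ => rfl) hf

@[fun_prop]
theorem intensionalPred {f : ε → Intensional K} (hf : PolyTime K f) :
    PolyTime K (fun x => (f x).pred) :=
  comp (of_path (f := Intensional.pred) [true, true, false] fun _ => rfl) hf

@[fun_prop]
theorem intensionalArgs {f : ε → Intensional K} (hf : PolyTime K f) :
    PolyTime K (fun x => (f x).args) :=
  comp (of_path (f := Intensional.args) [true, true, true] fun _ => rfl) hf

@[fun_prop]
theorem intensionalMatches {f : ε → Intensional K} {g : ε → Atom K} (hf : PolyTime K f)
    (hg : PolyTime K g) : PolyTime K (fun x => (f x).matches (g x)) := by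
  unfold Intensional.matches; fun_prop

@[fun_prop]
theorem intensionalValue {f : ε → Intensional K} {g : ε → Atom K} (hf : PolyTime K f)
    (hg : PolyTime K g) : PolyTime K (fun x => (f x).value (g x)) := by
  unfold Intensional.value; fun_prop

@[fun_prop]
theorem relOpElim {op : ε → RelOp} {f₀ f₁ f₂ f₃ f₄ f₅ : ε → α} (hop : PolyTime K op)
    (h₀ : PolyTime K f₀) (h₁ : PolyTime K f₁) (h₂ : PolyTime K f₂) (h₃ : PolyTime K f₃)
    (h₄ : PolyTime K f₄) (h₅ : PolyTime K f₅) :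
    PolyTime K (fun x => (op x).elim (f₀ x) (f₁ x) (f₂ x) (f₃ x) (f₄ x) (f₅ x)) := by
  -- `i o` is the number by which `o` is coded, so it has the same code as `o`, and the case
  -- distinction becomes a chain of comparisons of numbers.
  let i (o : RelOp) : ℕ := o.elim 0 1 2 3 4 5
  have hi : PolyTime K i := of_code_eq fun o => by cases o <;> rfl
  have : (fun x => (op x).elim (f₀ x) (f₁ x) (f₂ x) (f₃ x) (f₄ x) (f₅ x)) = fun x =>
      bif decide (i (op x) = 0) then f₀ x else bif decide (i (op x) = 1) then f₁ x else
      bif decide (i (op x) = 2) then f₂ x else bif decide (i (op x) = 3) then f₃ x else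
      bif decide (i (op x) = 4) then f₄ x else f₅ x := by
    funext x; cases op x <;> rfl
  rw [this]
  clear_value i
  fun_prop

@[fun_prop]
theorem aggFnElim {fn : ε → AggFn} {f₀ f₁ f₂ f₃ f₄ : ε → α} (hfn : PolyTime K fn)
    (h₀ : PolyTime K f₀) (h₁ : PolyTime K f₁) (h₂ : PolyTime K f₂) (h₃ : PolyTime K f₃)
    (h₄ : PolyTime K f₄) :
    PolyTime K (fun x => (fn x).elim (f₀ x) (f₁ x) (f₂ x) (f₃ x) (f₄ x)) := by
  let i (o : AggFn) : ℕ := o.elim 0 1 2 3 4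
  have hi : PolyTime K i := of_code_eq fun o => by cases o <;> rfl
  have : (fun x => (fn x).elim (f₀ x) (f₁ x) (f₂ x) (f₃ x) (f₄ x)) = fun x =>
      bif decide (i (fn x) = 0) then f₀ x else bif decide (i (fn x) = 1) then f₁ x else
      bif decide (i (fn x) = 2) then f₂ x else bif decide (i (fn x) = 3) then f₃ x else f₄ x := by
    funext x; cases fn x <;> rfl
  rw [this]
  clear_value i
  fun_prop

instance (op : RelOp) : Literal K op :=
  ⟨.lit (op.elim 0 1 2 3 4 5), 1, fun s => ⟨by
    show Data.num _ = _
    cases op <;> simp [RelOp.elim, code, RelOp.enc, encNat], le_rfl⟩⟩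

@[fun_prop]
theorem relOpFlip {op : ε → RelOp} (hop : PolyTime K op) : PolyTime K (fun x => (op x).flip) := by
  unfold RelOp.flip; fun_prop

@[fun_prop]
theorem posSum {f : ε → List K} (hf : PolyTime K f) : PolyTime K (fun x => posSum (f x)) := by
  unfold AggSol.posSum; fun_prop

@[fun_prop]
theorem negSum {f : ε → List K} (hf : PolyTime K f) : PolyTime K (fun x => negSum (f x)) := by
  unfold AggSol.negSum; fun_prop

@[fun_prop]
theorem sumCheck {op : ε → RelOp} {v : ε → K} {f g : ε → List K} (ho : PolyTime K op)
    (hv : PolyTime K v) (hf : PolyTime K f) (hg : PolyTime K g) :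
    PolyTime K (fun x => sumCheck (op x) (v x) (f x) (g x)) := by
  unfold AggSol.sumCheck; fun_prop

@[fun_prop]
theorem notCount {v : ε → K} {f : ε → List α} (hv : PolyTime K v) (hf : PolyTime K f) :
    PolyTime K (fun x => notCount (v x) (f x)) := by
  unfold AggSol.notCount
  -- The counter becomes `0` or `y - 1`, so a step adds at most the magnitudes of `0` and `1`.
  refine not (decide_eq (foldl_of_growth
    (step := fun _ y _ => bif decide (y = 0) then 0 else y - 1) hf hv (by fun_prop)
    (Polynomial.C (CostModel.mag (0 : K) + CostModel.mag (1 : K))) fun x y a _ => ?_) (by fun_prop))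
  have := CostModel.mag_sub y 1
  cases decide (y = 0) <;> simp only [cond_true, cond_false, code_num, Data.vol,
    Polynomial.eval_C] <;> omega

@[fun_prop]
theorem allNonneg {f : ε → List K} (hf : PolyTime K f) :
    PolyTime K (fun x => allNonneg (f x)) := by
  unfold AggSol.allNonneg; fun_prop

@[fun_prop]
theorem allPos {f : ε → List K} (hf : PolyTime K f) : PolyTime K (fun x => allPos (f x)) := by
  unfold AggSol.allPos; fun_prop

@[fun_prop]
theorem minCheck {op : ε → RelOp} {f g : ε → List K} (ho : PolyTime K op)
    (hf : PolyTime K f) (hg : PolyTime K g) :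
    PolyTime K (fun x => minCheck (op x) (f x) (g x)) := by
  unfold AggSol.minCheck; fun_prop

@[fun_prop]
theorem numeric {f : ε → List (Const K)} (hf : PolyTime K f) :
    PolyTime K (fun x => numeric (f x)) := by
  unfold AggSol.numeric; fun_prop

@[fun_prop]
theorem vals {f : ε → List (Const K)} (hf : PolyTime K f) : PolyTime K (fun x => vals (f x)) := by
  unfold AggSol.vals; fun_prop

@[fun_prop]
theorem groupCheck {fn : ε → AggFn} {op : ε → RelOp} {v : ε → K} {f g : ε → List (Const K)}
    (hn : PolyTime K fn) (ho : PolyTime K op) (hv : PolyTime K v) (hf : PolyTime K f)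
    (hg : PolyTime K g) : PolyTime K (fun x => groupCheck (fn x) (op x) (v x) (f x) (g x)) := by
  unfold AggSol.groupCheck; fun_prop

@[fun_prop]
theorem aggAtomFn {f : ε → AggAtom K} (hf : PolyTime K f) : PolyTime K (fun x => (f x).fn) :=
  comp (of_path (f := AggAtom.fn) [false] fun _ => rfl) hf

@[fun_prop]
theorem aggAtomOp {f : ε → AggAtom K} (hf : PolyTime K f) : PolyTime K (fun x => (f x).op) :=
  comp (of_path (f := AggAtom.op) [true, false] fun _ => rfl) hf

@[fun_prop]
theorem aggAtomV {f : ε → AggAtom K} (hf : PolyTime K f) : PolyTime K (fun x => (f x).v) :=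
  comp (of_path (f := AggAtom.v) [true, true, false] fun _ => rfl) hf

@[fun_prop]
theorem aggAtomS {f : ε → AggAtom K} (hf : PolyTime K f) : PolyTime K (fun x => (f x).s) :=
  comp (of_path (f := AggAtom.s) [true, true, true] fun _ => rfl) hf

@[fun_prop]
theorem fixedVals {l : ε → AggAtom K} {f : ε → List (Atom K)} (hl : PolyTime K l)
    (hf : PolyTime K f) : PolyTime K (fun x => (l x).fixedVals (f x)) := by
  unfold AggAtom.fixedVals; fun_prop

@[fun_prop]
theorem freeVals {l : ε → AggAtom K} {f g h : ε → List (Atom K)} (hl : PolyTime K l)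
    (hf : PolyTime K f) (hg : PolyTime K g) (hh : PolyTime K h) :
    PolyTime K (fun x => (l x).freeVals (f x) (g x) (h x)) := by
  unfold AggAtom.freeVals; fun_prop

@[fun_prop]
theorem solutionCheck {l : ε → AggAtom K} {f g h : ε → List (Atom K)} (hl : PolyTime K l)
    (hf : PolyTime K f) (hg : PolyTime K g) (hh : PolyTime K h) :
    PolyTime K (fun x => (l x).solutionCheck (f x) (g x) (h x)) := by
  unfold AggAtom.solutionCheck; fun_prop

@[fun_prop]
theorem extList {l : ε → AggAtom K} {f : ε → List (Atom K)} (hl : PolyTime K l)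
    (hf : PolyTime K f) : PolyTime K (fun x => (l x).extList (f x)) := by
  unfold AggAtom.extList; fun_prop

@[fun_prop]
theorem condCheck {l : ε → AggAtom K} {f g h : ε → List (Atom K)} (hl : PolyTime K l)
    (hf : PolyTime K f) (hg : PolyTime K g) (hh : PolyTime K h) :
    PolyTime K (fun x => (l x).condCheck (f x) (g x) (h x)) := by
  unfold AggAtom.condCheck; fun_prop

@[fun_prop]
theorem ruleHead {f : ε → Rule K} (hf : PolyTime K f) : PolyTime K (fun x => (f x).head) :=
  comp (of_path (f := Rule.head) [false] fun _ => rfl) hf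

@[fun_prop]
theorem ruleAggs {f : ε → Rule K} (hf : PolyTime K f) : PolyTime K (fun x => (f x).aggs) :=
  comp (of_path (f := Rule.aggs) [true, false] fun _ => rfl) hf

@[fun_prop]
theorem rulePos {f : ε → Rule K} (hf : PolyTime K f) : PolyTime K (fun x => (f x).pos) :=
  comp (of_path (f := Rule.pos) [true, true, false] fun _ => rfl) hf

@[fun_prop]
theorem ruleNeg {f : ε → Rule K} (hf : PolyTime K f) : PolyTime K (fun x => (f x).neg) :=
  comp (of_path (f := Rule.neg) [true, true, true] fun _ => rfl) hf

@[fun_prop]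
theorem ruleFires {r : ε → Rule K} {f g h : ε → List (Atom K)} (hr : PolyTime K r)
    (hf : PolyTime K f) (hg : PolyTime K g) (hh : PolyTime K h) :
    PolyTime K (fun x => (r x).fires (f x) (g x) (h x)) := by
  unfold Rule.fires; fun_prop

@[fun_prop]
theorem consequenceList {P : ε → List (Rule K)} {f g h : ε → List (Atom K)} (hP : PolyTime K P)
    (hf : PolyTime K f) (hg : PolyTime K g) (hh : PolyTime K h) :
    PolyTime K (fun x => consequenceList (f x) (P x) (g x) (h x)) := by
  unfold AggSol.consequenceList; fun_prop

-- Every intermediate state is empty or a filtered copy of the base, hence a sublist of it; a bound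
-- on the growth per step is not needed.
@[fun_prop]
theorem leastModel {P : ε → List (Rule K)} {f g : ε → List (Atom K)} (hP : PolyTime K P)
    (hf : PolyTime K f) (hg : PolyTime K g) :
    PolyTime K (fun x => leastModel (f x) (P x) (g x)) := by
  have ⟨p, hp, _⟩ := hf
  refine foldl_of_bound (init := fun _ => [])
    (step := fun x I _ => AggSol.consequenceList (f x) (P x) (g x) I) hf (by fun_prop)
    (by fun_prop) p fun x l _ => (vol_le_of_sublist ?_).trans (hp x)
  obtain rfl | ⟨l, a, rfl⟩ := l.eq_nil_or_concat
  · simp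
  · rw [List.concat_eq_append, List.foldl_concat]
    exact List.filter_sublist

@[fun_prop]
theorem answerSetCheck {P : ε → List (Rule K)} {f g : ε → List (Atom K)} (hP : PolyTime K P)
    (hf : PolyTime K f) (hg : PolyTime K g) :
    PolyTime K (fun x => answerSetCheck (f x) (P x) (g x)) := by
  unfold AggSol.answerSetCheck; fun_prop

@[fun_prop]
theorem selectAtoms {f : ε → List (Atom K)} {y : ε → Data K} (hf : PolyTime K f)
    (hy : PolyTime K y) : PolyTime K (fun x => selectAtoms (f x) (y x)) := by
  have ⟨p, hp, _⟩ := hf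
  refine snd (foldl_of_growth (init := fun x => (y x, []))
    (step := fun _ z a => (z.1.tl, bif z.1.hd.truthy then a :: z.2 else z.2)) hf (by fun_prop)
    (by fun_prop) (p + 1) fun x z a ha => ?_)
  have h₁ := (vol_le_of_mem (K := K) ha).trans (hp x)
  have h₂ := Data.vol_tl_le z.1
  simp only [code_pair, Data.vol, Polynomial.eval_add, Polynomial.eval_one]
  change _ + (z.1.tl).vol + _ ≤ _ + (z.1).vol + _ + _
  cases z.1.hd.truthy
  · simp only [cond_false]; omega
  · simp only [cond_true, code_cons, Data.vol]; omega

end PolyTime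
end Algorithms

/-! ### Correctness of the algorithms -/

section Correctness

variable {K : Type} [Field K] [LinearOrder K] [IsStrictOrderedRing K]

/-! ### Equality tests, matching and the values of the grouped variable -/

theorem Const.same_iff (a b : Const K) : a.same b = true ↔ a = b := by
  cases a <;> cases b <;>
    simp only [Const.same, Const.isNum, Const.val, cond_true, cond_false, Bool.true_and,
      Bool.not_true, Bool.not_false, Bool.false_and, decide_eq_true_eq, Const.num.injEq,
      Const.sym.injEq, Nat.cast_inj, reduceCtorEq]
  exact decide_eq_true_iff

theorem Term.same_iff (t u : Term K) : t.same u = true ↔ t = u := by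
  cases t <;> cases u <;> simp [Term.same, Term.isVar, Term.toConst, Const.same_iff]

theorem sameArgs_iff (cs ds : List (Const K)) : sameArgs cs ds = true ↔ cs = ds := by
  simp only [sameArgs, Nat.cast_inj, Bool.and_eq_true, decide_eq_true_eq]
  induction cs generalizing ds with
  | nil => cases ds <;> simp
  | cons c cs ih =>
    cases ds with
    | nil => simp
    | cons d ds => simp [← ih, Const.same_iff]; tauto

theorem Atom.same_iff (a b : Atom K) : a.same b = true ↔ a = b := by
  cases a; cases b
  simp [Atom.same, sameArgs_iff]

theorem memAtom_iff (l : List (Atom K)) (a : Atom K) : memAtom l a = true ↔ a ∈ l := by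
  simp [memAtom, Atom.same_iff]

theorem mem_zip_map {α β : Type} {f : α → β} {l : List α} {z : α × β} (h : z ∈ l.zip (l.map f)) :
    z.1 ∈ l ∧ z.2 = f z.1 := by
  induction l with
  | nil => simp at h
  | cons a l ih =>
    simp only [List.map_cons, List.zip_cons_cons, List.mem_cons] at h
    rcases h with rfl | h
    · simp
    · exact ⟨by simp [(ih h).1], (ih h).2⟩

theorem matchArgs_iff (ts : List (Term K)) (cs : List (Const K)) :
    matchArgs ts cs = true ↔ ∃ γ : ℕ → Const K, ts.map (Term.inst γ) = cs := by
  classical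
  simp only [matchArgs, fits, Nat.cast_inj, Bool.and_eq_true, decide_eq_true_eq, List.all_eq_true,
    Bool.or_eq_true, Bool.not_eq_true', ← Bool.not_eq_true, Term.same_iff, Const.same_iff]
  constructor
  · rintro ⟨hl, h⟩
    -- A variable receives the constant facing some occurrence of it, and `fits` makes the choice
    -- irrelevant. Variables that do not occur get the dummy value `sym 0`.
    refine ⟨fun i => if hi : ∃ c, (Term.var i, c) ∈ ts.zip cs then hi.choose else .sym 0,
      List.ext_getElem (by simpa using hl) fun k h₁ h₂ => ?_⟩
    have h₀ : k < ts.length := by simpa using h₁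
    have hz : (ts[k], cs[k]) ∈ ts.zip cs := by
      have hk : k < (ts.zip cs).length := by simp [h₀, h₂]
      rw [← List.getElem_zip (h := hk)]
      exact List.getElem_mem hk
    obtain ⟨hc, hv⟩ := h _ hz
    rw [List.getElem_map]
    cases ht : ts[k] with
    | const c => simpa [ht, Term.isVar, Term.toConst, Term.inst] using hc
    | var i =>
      rw [ht] at hz hv
      have hi : ∃ c, (Term.var i, c) ∈ ts.zip cs := ⟨_, hz⟩
      have := hv _ hi.choose_spec
      simp only [Term.inst, dif_pos hi]
      exact (this.resolve_left fun h => h rfl).symm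
  · rintro ⟨γ, rfl⟩
    refine ⟨by simp, fun z hz => ⟨?_, fun y hy => ?_⟩⟩
    · have := (mem_zip_map hz).2
      obtain ⟨t, c⟩ := z
      cases t <;> simp_all [Term.isVar, Term.toConst, Term.inst]
    · rw [(mem_zip_map hz).2, (mem_zip_map hy).2]
      by_cases h : z.1 = y.1
      · right; rw [h]
      · exact Or.inl h

theorem Intensional.matches_iff (s : Intensional K) (a : Atom K) :
    s.matches a = true ↔ ∃ γ : ℕ → Const K, s.inst γ = a := by
  obtain ⟨p, cs⟩ := a
  simp only [Intensional.matches, matchArgs_iff, Bool.and_eq_true, decide_eq_true_eq,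
    Intensional.inst, Atom.mk.injEq]
  exact ⟨fun ⟨h, γ, h'⟩ => ⟨γ, h.symm, h'⟩, fun ⟨γ, h, h'⟩ => ⟨h.symm, γ, h'⟩⟩

/-- In an instance all occurrences of the grouped variable face the same constant, and there is at
least one occurrence, so the default of `headD` is not used. -/
theorem Intensional.value_eq_proj (s : Intensional K) {a : Atom K} (h : s.matches a = true) :
    s.value a = s.proj a := by
  obtain ⟨γ, rfl⟩ := (s.matches_iff a).1 h
  rw [Intensional.proj_inst]
  set l := (s.args.zip (s.inst γ).args).filter fun z =>
    z.1.isVar && z.1.toConst.same (.num s.grouped) with hl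
  have h₁ : ∀ z ∈ l, z.2 = γ s.grouped := by
    rintro ⟨t, c⟩ hz
    obtain ⟨hz, ht⟩ := List.mem_filter.1 hz
    obtain ⟨-, hc⟩ := mem_zip_map hz
    cases t <;> simp_all [Term.isVar, Term.toConst, Const.same_iff, Term.inst]
  have h₂ : l ≠ [] := by
    have hm : ((Term.var s.grouped, γ s.grouped) : Term K × Const K) ∈ l := by
      refine List.mem_filter.2 ⟨?_, by simp [Term.isVar, Term.toConst, Const.same_iff]⟩
      obtain ⟨k, hk, hk'⟩ := List.mem_iff_getElem.1 s.grouped_mem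
      have h' : k < (s.args.zip (s.inst γ).args).length := by simp [Intensional.inst, hk]
      have : (s.args.zip (s.inst γ).args)[k] = (Term.var s.grouped, γ s.grouped) := by
        rw [List.getElem_zip, hk']
        simp [Intensional.inst, hk', Term.inst]
      rw [← this]
      exact List.getElem_mem h'
    exact List.ne_nil_of_mem hm
  show (l.map fun z => z.2).headD _ = _
  cases hl' : l with
  | nil => exact absurd hl' h₂
  | cons z l' => exact h₁ z (by simp [hl'])

theorem Intensional.mem_support {s : Intensional K} {M : Finset (Atom K)} {a : Atom K} :
    a ∈ s.support M ↔ a ∈ M ∧ ∃ γ : ℕ → Const K, s.inst γ = a := by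
  simp [Intensional.support]

/-- In an intensional set the grouped variable is the only variable, so its value determines the
instance. Hence `proj` is injective on the support, and sets can be treated as multisets. -/
theorem Intensional.interp_eq (s : Intensional K) (M : Finset (Atom K)) :
    s.interp M = (s.support M).val.map s.proj := by
  unfold Intensional.interp
  cases hk : s.kind with
  | multiset => rfl
  | set =>
    refine Finset.image_val_of_injOn fun a ha b hb h => ?_
    obtain ⟨-, γ, rfl⟩ := mem_support.1 (Finset.mem_coe.1 ha)
    obtain ⟨-, δ, rfl⟩ := mem_support.1 (Finset.mem_coe.1 hb)
    rw [s.proj_inst, s.proj_inst] at h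
    unfold Intensional.inst
    congr 1
    refine List.map_congr_left fun t ht => ?_
    cases t with
    | const c => rfl
    | var i => rw [s.set_no_local hk i ht]; exact h

/-! Bounds for the parts of a list of numbers -/

theorem sum_le_posSum {T F : List K} (h : T.Sublist F) : T.sum ≤ posSum F := by
  unfold posSum
  induction h with
  | slnil => simp
  | cons a h ih =>
    by_cases ha : 0 < a <;> simp [ha] at ih ⊢ <;> linarith
  | cons_cons a h ih =>
    by_cases ha : 0 < a <;> simp [ha] at ih ⊢ <;> linarith

theorem negSum_le_sum {T F : List K} (h : T.Sublist F) : negSum F ≤ T.sum := by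
  unfold negSum
  induction h with
  | slnil => simp
  | cons a h ih =>
    by_cases ha : a < 0 <;> simp [ha] at ih ⊢ <;> linarith
  | cons_cons a h ih =>
    by_cases ha : a < 0 <;> simp [ha] at ih ⊢ <;> linarith

theorem sum_filter_pos (F : List K) : (F.filter fun y => decide (0 < y)).sum = posSum F := by
  unfold posSum
  induction F with
  | nil => rfl
  | cons a F ih => by_cases ha : 0 < a <;> simp [ha] at ih ⊢ <;> linarith

theorem sum_filter_neg (F : List K) : (F.filter fun y => decide (y < 0)).sum = negSum F := by
  unfold negSum
  induction F with
  | nil => rfl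
  | cons a F ih => by_cases ha : a < 0 <;> simp [ha] at ih ⊢ <;> linarith

/-- All sums lie between two extremes, and both are attained: by the positive members of `F` and by
the negative ones. Equality holds throughout iff both extremes equal `v`. -/
theorem sumCheck_iff {op : RelOp} (hop : op ≠ .ne) (v : K) (D F : List K) :
    sumCheck op v D F = true ↔ ∀ T, T.Sublist F → op.Holds (D ++ T).sum v := by
  have hu : ∀ T, T.Sublist F → (D ++ T).sum ≤ D.sum + posSum F := fun T h => by
    rw [List.sum_append]; linarith [sum_le_posSum h]
  have hl : ∀ T, T.Sublist F → D.sum + negSum F ≤ (D ++ T).sum := fun T h => by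
    rw [List.sum_append]; linarith [negSum_le_sum h]
  have eu : ∃ T, T.Sublist F ∧ (D ++ T).sum = D.sum + posSum F :=
    ⟨_, List.filter_sublist, by rw [List.sum_append, sum_filter_pos]⟩
  have el : ∃ T, T.Sublist F ∧ (D ++ T).sum = D.sum + negSum F :=
    ⟨_, List.filter_sublist, by rw [List.sum_append, sum_filter_neg]⟩
  obtain ⟨U, hU, eU⟩ := eu
  obtain ⟨L, hL, eL⟩ := el
  cases op
  · simp only [sumCheck, RelOp.elim, RelOp.Holds, Bool.and_eq_true, decide_eq_true_eq]
    exact ⟨fun h T hT => le_antisymm ((hu T hT).trans h.1) (h.2.trans (hl T hT)),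
      fun h => ⟨(eU ▸ h U hU).le, (eL ▸ h L hL).ge⟩⟩
  · exact absurd rfl hop
  · simp only [sumCheck, RelOp.elim, RelOp.Holds, decide_eq_true_eq]
    exact ⟨fun h T hT => (hu T hT).trans_lt h, fun h => eU ▸ h U hU⟩
  · simp only [sumCheck, RelOp.elim, RelOp.Holds, decide_eq_true_eq]
    exact ⟨fun h T hT => h.trans_le (hl T hT), fun h => eL ▸ h L hL⟩
  · simp only [sumCheck, RelOp.elim, RelOp.Holds, decide_eq_true_eq]
    exact ⟨fun h T hT => (hu T hT).trans h, fun h => eU ▸ h U hU⟩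
  · simp only [sumCheck, RelOp.elim, RelOp.Holds, decide_eq_true_eq]
    exact ⟨fun h T hT => h.trans (hl T hT), fun h => eL ▸ h L hL⟩

/-- The fold counts down from `x`, with `0` absorbing, and so ends at `0` exactly when `x` is one of
`0, …, |F|`. Each of these is the length of an initial segment of `F`. -/
theorem notCount_iff {α : Type} (x : K) (F : List α) :
    notCount x F = true ↔ ∀ T : List α, T.Sublist F → (T.length : K) ≠ x := by
  have h : ∀ (F : List α) (x : K),
      F.foldl (fun y _ => bif decide (y = 0) then 0 else y - 1) x = 0 ↔
        ∃ k ≤ F.length, (k : K) = x := by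
    intro F
    induction F with
    | nil => intro x; simp [eq_comm]
    | cons a F ih =>
      intro x
      rw [List.foldl_cons, ih]
      by_cases hx : x = 0
      · subst hx
        simp only [decide_true, cond_true]
        exact ⟨fun _ => ⟨0, by simp⟩, fun _ => ⟨0, by simp⟩⟩
      · simp only [hx, decide_false, cond_false, List.length_cons]
        constructor
        · rintro ⟨k, hk, e⟩
          exact ⟨k + 1, by omega, by push_cast; linarith⟩
        · rintro ⟨k, hk, e⟩
          obtain _ | k := k
          · exact absurd (by simpa using e.symm) hx
          · exact ⟨k, by omega, by push_cast at e; linarith⟩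
  rw [notCount, Bool.not_eq_true', ← Bool.not_eq_true, decide_eq_true_eq, h]
  constructor
  · exact fun hn T hT e => hn ⟨_, hT.length_le, e⟩
  · rintro hn ⟨k, hk, e⟩
    exact hn (F.take k) (List.take_sublist k F) (by simpa [hk] using e)

/-- A larger group is less likely to be all nonnegative or all positive, so the critical `T` is `F`
for these properties and `[]` for their negations. For `≠`, the minimum `0` can be attained iff `D`
is nonnegative and contains `0`, or `D` is nonnegative and a single `0` from `F` is added. -/
theorem minCheck_iff (op : RelOp) (D F : List K) :
    minCheck op D F = true ↔ ∀ T, T.Sublist F →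
      op.elim ((∀ x ∈ D ++ T, 0 ≤ x) ∧ ¬ ∀ x ∈ D ++ T, 0 < x)
        ((∀ x ∈ D ++ T, 0 ≤ x) → ∀ x ∈ D ++ T, 0 < x)
        (¬ ∀ x ∈ D ++ T, 0 ≤ x) (∀ x ∈ D ++ T, 0 < x)
        (¬ ∀ x ∈ D ++ T, 0 < x) (∀ x ∈ D ++ T, 0 ≤ x) := by
  have h₀ := List.nil_sublist F
  have h₁ := List.Sublist.refl F
  have hP : ∀ l : List K, allNonneg l = true ↔ ∀ x ∈ l, 0 ≤ x := fun l => by simp [allNonneg]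
  have hQ : ∀ l : List K, allPos l = true ↔ ∀ x ∈ l, 0 < x := fun l => by simp [allPos]
  have app : ∀ (p : K → Prop) (T : List K), (∀ x ∈ D ++ T, p x) ↔
      (∀ x ∈ D, p x) ∧ ∀ x ∈ T, p x := fun p T => List.forall_mem_append
  cases op <;> simp only [minCheck, RelOp.elim, Bool.and_eq_true, Bool.not_eq_true',
    ← Bool.not_eq_true, Bool.or_eq_true, hP, hQ, app, List.any_eq_true, decide_eq_true_eq]
  · constructor
    · rintro ⟨⟨hD, hF⟩, hn⟩ T hT
      exact ⟨⟨hD, fun x hx => hF x (hT.subset hx)⟩, fun h => hn h.1⟩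
    · intro h
      exact ⟨(h F h₁).1, fun hq => (h [] h₀).2 ⟨hq, by simp⟩⟩
  · constructor
    · rintro hn T hT ⟨hD, hT'⟩
      have hq : ∀ x ∈ D, 0 < x := by
        by_contra hq
        exact hn ⟨hD, Or.inl hq⟩
      refine ⟨hq, fun x hx => lt_of_le_of_ne (hT' x hx) fun e => hn ⟨hD, Or.inr ⟨x, hT.subset hx,
        e.symm⟩⟩⟩
    · rintro h ⟨hD, hq | ⟨x, hx, rfl⟩⟩
      · exact hq (h [] h₀ ⟨hD, by simp⟩).1
      · have := (h [0] (List.singleton_sublist.2 hx) ⟨hD, by simp⟩).2 0 (by simp)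
        exact lt_irrefl _ this
  · exact ⟨fun h T _ hT => h hT.1, fun h hD => h [] h₀ ⟨hD, by simp⟩⟩
  · exact ⟨fun h T hT => ⟨h.1, fun x hx => h.2 x (hT.subset hx)⟩, fun h => h F h₁⟩
  · exact ⟨fun h T _ hT => h hT.1, fun h hD => h [] h₀ ⟨hD, by simp⟩⟩
  · exact ⟨fun h T hT => ⟨h.1, fun x hx => h.2 x (hT.subset hx)⟩, fun h => h F h₁⟩

/-! Evaluation of aggregates on lists -/

theorem numeric_iff (l : List (Const K)) :
    numeric l = true ↔ ∀ c ∈ (l : Multiset (Const K)), c.num? ≠ none := by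
  simp only [numeric, List.all_eq_true, Multiset.mem_coe]
  refine forall₂_congr fun c _ => ?_
  cases c <;> simp [Const.isNum, Const.num?]

theorem filterMap_eq_vals {l : List (Const K)} (h : numeric l = true) :
    Multiset.filterMap Const.num? (l : Multiset (Const K)) = (vals l : Multiset K) := by
  rw [Multiset.filterMap_coe]
  congr 1
  induction l with
  | nil => rfl
  | cons c l ih =>
    simp only [numeric, List.all_cons, Bool.and_eq_true] at h
    have := ih h.2
    cases c with
    | num x => simpa [Const.num?, vals, Const.val] using this
    | sym n => simp [Const.isNum] at h

theorem holds_coe (op : RelOp) (x v : K) :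
    op.Holds (((x : WithTop K) : WithBot (WithTop K))) ((v : WithTop K) : WithBot (WithTop K)) ↔
      op.Holds x v := by
  cases op <;> simp [RelOp.Holds]

/-- Reduces all six relations to `v ≤ x` and `v < x`, the two comparisons that an infimum passes on
to its members. -/
theorem holds_iff_elim_ge {V : Type} [LinearOrder V] (op : RelOp) (x v : V) :
    op.Holds x v ↔ op.elim (v ≤ x ∧ ¬ v < x) (v ≤ x → v < x) (¬ v ≤ x) (v < x) (¬ v < x)
      (v ≤ x) := by
  cases op <;> simp only [RelOp.Holds, RelOp.elim, not_lt, not_le]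
  · exact ⟨fun h => ⟨h.ge, h.le⟩, fun h => le_antisymm h.2 h.1⟩
  · exact ⟨fun h h' => lt_of_le_of_ne h' h.symm, fun h e => (h e.ge).ne e.symm⟩

theorem holds_iff_elim_le {V : Type} [LinearOrder V] (op : RelOp) (x v : V) :
    op.Holds x v ↔ op.flip.elim (x ≤ v ∧ ¬ x < v) (x ≤ v → x < v) (¬ x ≤ v) (x < v) (¬ x < v)
      (x ≤ v) := by
  cases op <;> simp only [RelOp.Holds, RelOp.flip, RelOp.elim, not_lt, not_le]
  · exact ⟨fun h => ⟨h.le, h.ge⟩, fun h => le_antisymm h.1 h.2⟩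
  · exact ⟨fun h h' => lt_of_le_of_ne h' h, fun h e => (h e.le).ne e⟩

/-- A finite infimum is at least (exceeds) `v` iff every member does. The strict case includes the
empty list, whose infimum `+∞` exceeds every number. -/
theorem holds_inf_iff (op : RelOp) (l : List K) (v : K) :
    op.Holds (((l : Multiset K).map fun x : K => ((x : WithTop K) : WithBot (WithTop K))).inf)
      ((v : WithTop K) : WithBot (WithTop K)) ↔
    op.elim ((∀ x ∈ l.map fun x => x - v, 0 ≤ x) ∧ ¬ ∀ x ∈ l.map fun x => x - v, 0 < x)
      ((∀ x ∈ l.map fun x => x - v, 0 ≤ x) → ∀ x ∈ l.map fun x => x - v, 0 < x)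
      (¬ ∀ x ∈ l.map fun x => x - v, 0 ≤ x) (∀ x ∈ l.map fun x => x - v, 0 < x)
      (¬ ∀ x ∈ l.map fun x => x - v, 0 < x) (∀ x ∈ l.map fun x => x - v, 0 ≤ x) := by
  have h₁ : ((v : WithTop K) : WithBot (WithTop K)) ≤
      ((l : Multiset K).map fun x : K => ((x : WithTop K) : WithBot (WithTop K))).inf ↔
      ∀ x ∈ l.map fun x => x - v, 0 ≤ x := by
    simp only [Multiset.le_inf, Multiset.mem_map, List.forall_mem_map, sub_nonneg, and_imp,
      forall_exists_index, forall_apply_eq_imp_iff₂, Multiset.mem_coe, WithBot.coe_le_coe,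
      WithTop.coe_le_coe]
  have h₂ : ((v : WithTop K) : WithBot (WithTop K)) <
      ((l : Multiset K).map fun x : K => ((x : WithTop K) : WithBot (WithTop K))).inf ↔
      ∀ x ∈ l.map fun x => x - v, 0 < x := by
    clear h₁
    induction l with
    | nil => simpa using (WithBot.coe_lt_coe.2 (WithTop.coe_lt_top v))
    | cons a l ih =>
      rw [← Multiset.cons_coe, Multiset.map_cons, Multiset.inf_cons, lt_inf_iff, ih]
      simp
  rw [holds_iff_elim_ge, h₁, h₂]

theorem holds_sup_iff (op : RelOp) (l : List K) (v : K) :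
    op.Holds (((l : Multiset K).map fun x : K => ((x : WithTop K) : WithBot (WithTop K))).sup)
      ((v : WithTop K) : WithBot (WithTop K)) ↔
    op.flip.elim ((∀ x ∈ l.map fun x => v - x, 0 ≤ x) ∧ ¬ ∀ x ∈ l.map fun x => v - x, 0 < x)
      ((∀ x ∈ l.map fun x => v - x, 0 ≤ x) → ∀ x ∈ l.map fun x => v - x, 0 < x)
      (¬ ∀ x ∈ l.map fun x => v - x, 0 ≤ x) (∀ x ∈ l.map fun x => v - x, 0 < x)
      (¬ ∀ x ∈ l.map fun x => v - x, 0 < x) (∀ x ∈ l.map fun x => v - x, 0 ≤ x) := by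
  have h₁ : ((l : Multiset K).map fun x : K => ((x : WithTop K) : WithBot (WithTop K))).sup ≤
      ((v : WithTop K) : WithBot (WithTop K)) ↔ ∀ x ∈ l.map fun x => v - x, 0 ≤ x := by
    simp only [Multiset.sup_le, Multiset.mem_map, List.forall_mem_map, sub_nonneg, and_imp,
      forall_exists_index, forall_apply_eq_imp_iff₂, Multiset.mem_coe, WithBot.coe_le_coe,
      WithTop.coe_le_coe]
  have h₂ : ((l : Multiset K).map fun x : K => ((x : WithTop K) : WithBot (WithTop K))).sup <
      ((v : WithTop K) : WithBot (WithTop K)) ↔ ∀ x ∈ l.map fun x => v - x, 0 < x := by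
    clear h₁
    induction l with
    | nil => simp
    | cons a l ih =>
      rw [← Multiset.cons_coe, Multiset.map_cons, Multiset.sup_cons, sup_lt_iff, ih]
      simp
  rw [holds_iff_elim_le, h₁, h₂]

/-- Together with `sum_map_sub_const`, this turns a condition on an average into one on the sum of
the differences `x - v`, with no division. -/
theorem holds_div_iff (op : RelOp) (a v : K) {c : K} (hc : 0 < c) :
    op.Holds (a / c) v ↔ op.Holds (a - c * v) 0 := by
  cases op <;> simp only [RelOp.Holds]
  · rw [div_eq_iff hc.ne', sub_eq_zero, mul_comm]
  · rw [ne_eq, ne_eq, div_eq_iff hc.ne', sub_eq_zero, mul_comm]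
  · rw [div_lt_iff₀ hc, sub_neg, mul_comm]
  · rw [lt_div_iff₀ hc, sub_pos, mul_comm]
  · rw [div_le_iff₀ hc, sub_nonpos, mul_comm]
  · rw [le_div_iff₀ hc, sub_nonneg, mul_comm]

theorem sum_map_sub_const (l : List K) (v : K) :
    (l.map fun x => x - v).sum = l.sum - l.length * v := by
  induction l with
  | nil => simp
  | cons a l ih => simp [ih]; ring

theorem forall_sublist_map {α β : Type} {f : α → β} {F : List α} {Q : List β → Prop} :
    (∀ T : List β, T.Sublist (F.map f) → Q T) ↔ ∀ T : List α, T.Sublist F → Q (T.map f) := by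
  refine ⟨fun h T hT => h _ (hT.map f), fun h T hT => ?_⟩
  obtain ⟨T', hT', rfl⟩ := List.sublist_map_iff.1 hT
  exact h T' hT'

theorem numeric_append (D T : List (Const K)) :
    numeric (D ++ T) = (numeric D && numeric T) := by
  simp [numeric]

theorem numeric_of_sublist {T F : List (Const K)} (h : T.Sublist F) (hF : numeric F = true) :
    numeric T = true := by
  simp only [numeric, List.all_eq_true] at hF ⊢
  exact fun c hc => hF c (h.subset hc)

/-- If the aggregate is only defined on numeric groups, then all values must be numbers. -/
theorem forall_sublist_numeric {D F : List (Const K)} {b : Bool} {Q R : List (Const K) → Prop}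
    (hQ : ∀ l, Q l ↔ numeric l = true ∧ R l)
    (hb : b = true ↔ ∀ T, T.Sublist F → R (D ++ T)) :
    (numeric D && numeric F && b) = true ↔ ∀ T, T.Sublist F → Q (D ++ T) := by
  simp only [Bool.and_eq_true, hQ, hb]
  constructor
  · rintro ⟨⟨hD, hF⟩, h⟩ T hT
    exact ⟨by rw [numeric_append, hD, numeric_of_sublist hT hF]; rfl, h T hT⟩
  · intro h
    -- The largest group `D ++ F` already forces all values to be numbers.
    have := (h F (List.Sublist.refl F)).1
    rw [numeric_append, Bool.and_eq_true] at this
    exact ⟨this, fun T hT => (h T hT).2⟩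

theorem groupCheck_iff {fn : AggFn} {op : RelOp}
    (h : (fn ≠ AggFn.sum ∧ fn ≠ AggFn.avg) ∨ op ≠ RelOp.ne) (v : K) (D F : List (Const K)) :
    groupCheck fn op v D F = true ↔ ∀ T, T.Sublist F →
      ∃ y, fn.eval ((D ++ T : List (Const K)) : Multiset (Const K)) = some y ∧
        op.Holds y ((v : WithTop K) : WithBot (WithTop K)) := by
  cases fn
  · refine forall_sublist_numeric (R := fun l => op.Holds (vals l).sum v)
      (Q := fun l => ∃ y, AggFn.sum.eval (l : Multiset (Const K)) = some y ∧
        op.Holds y ((v : WithTop K) : WithBot (WithTop K))) (fun l => ?_) ?_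
    · by_cases hl : numeric l = true
      · simp only [AggFn.eval, if_pos ((numeric_iff l).1 hl), filterMap_eq_vals hl, hl,
          Multiset.sum_coe, Option.some.injEq, exists_eq_left', holds_coe, true_and]
      · simp only [AggFn.eval, if_neg (fun h => hl ((numeric_iff l).2 h)), hl]
        simp
    · rw [sumCheck_iff (by simpa using h), vals, forall_sublist_map]
      simp [vals]
  · have hc : ∀ l : List (Const K), (∃ y, AggFn.count.eval (l : Multiset (Const K)) = some y ∧
        op.Holds y ((v : WithTop K) : WithBot (WithTop K))) ↔ op.Holds (l.length : K) v := by
      intro l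
      simp only [AggFn.eval, Option.some.injEq, exists_eq_left', holds_coe, Multiset.coe_card]
    simp only [hc]
    -- Counting is summing ones.
    have hs : op ≠ .ne → (sumCheck op v (D.map fun _ => 1) (F.map fun _ => 1) = true ↔
        ∀ T, T.Sublist F → op.Holds ((D ++ T).length : K) v) := by
      intro hop
      rw [sumCheck_iff hop, forall_sublist_map]
      simp
    cases op
    case ne =>
      show notCount _ _ = true ↔ _
      rw [notCount_iff]
      refine forall₂_congr fun T _ => ?_
      simp only [RelOp.Holds, List.length_append, Nat.cast_add, ne_eq, eq_sub_iff_add_eq']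
    all_goals exact hs (by simp)
  · refine forall_sublist_numeric (Q := fun l => ∃ y, AggFn.min.eval (l : Multiset (Const K)) =
      some y ∧ op.Holds y ((v : WithTop K) : WithBot (WithTop K))) (R := fun l => op.Holds
      ((((vals l : List K) : Multiset K).map fun x : K => ((x : WithTop K) : WithBot (WithTop K))).inf)
      ((v : WithTop K) : WithBot (WithTop K))) (fun l => ?_) ?_
    · by_cases hl : numeric l = true
      · simp only [AggFn.eval, if_pos ((numeric_iff l).1 hl), filterMap_eq_vals hl, hl,
          Option.some.injEq, exists_eq_left', true_and]
      · simp only [AggFn.eval, if_neg (fun h => hl ((numeric_iff l).2 h)), hl]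
        simp
    · simp only [holds_inf_iff]
      rw [minCheck_iff, vals, vals, forall_sublist_map, forall_sublist_map]
      simp only [vals, List.map_append]
  · refine forall_sublist_numeric (Q := fun l => ∃ y, AggFn.max.eval (l : Multiset (Const K)) =
      some y ∧ op.Holds y ((v : WithTop K) : WithBot (WithTop K))) (R := fun l => op.Holds
      ((((vals l : List K) : Multiset K).map fun x : K => ((x : WithTop K) : WithBot (WithTop K))).sup)
      ((v : WithTop K) : WithBot (WithTop K))) (fun l => ?_) ?_
    · by_cases hl : numeric l = true
      · simp only [AggFn.eval, if_pos ((numeric_iff l).1 hl), filterMap_eq_vals hl, hl,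
          Option.some.injEq, exists_eq_left', true_and]
      · simp only [AggFn.eval, if_neg (fun h => hl ((numeric_iff l).2 h)), hl]
        simp
    · simp only [holds_sup_iff]
      rw [minCheck_iff, vals, vals, forall_sublist_map, forall_sublist_map]
      simp only [vals, List.map_append]
  · show (numeric D && numeric F && !D.isEmpty && _) = true ↔ _
    rw [Bool.and_assoc]
    refine forall_sublist_numeric (Q := fun l => ∃ y, AggFn.avg.eval (l : Multiset (Const K)) =
      some y ∧ op.Holds y ((v : WithTop K) : WithBot (WithTop K))) (R := fun l => l ≠ [] ∧
        op.Holds ((vals l).map fun x => x - v).sum 0) (fun l => ?_) ?_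
    · by_cases hl : numeric l = true
      · by_cases h0 : l = []
        · simp [AggFn.eval, h0]
        · have hpos : (0 : K) < (vals l).length := by
            simpa [vals, List.length_pos_iff] using h0
          have h0' : (l : Multiset (Const K)) ≠ 0 := by simpa using h0
          simp only [AggFn.eval, if_pos (And.intro ((numeric_iff l).1 hl) h0'),
            filterMap_eq_vals hl, hl, Option.some.injEq, exists_eq_left', holds_coe, true_and,
            Multiset.sum_coe, Multiset.coe_card, holds_div_iff op _ v hpos, sum_map_sub_const, h0,
            ne_eq, not_false_eq_true]
      · simp only [AggFn.eval, if_neg (fun h => hl ((numeric_iff l).2 (And.left h))), hl]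
        simp
    · rw [Bool.and_eq_true, sumCheck_iff (by simpa using h), vals, vals, forall_sublist_map,
        forall_sublist_map]
      simp only [vals, List.map_append]
      constructor
      · rintro ⟨h₁, h₂⟩ T hT
        exact ⟨by simp at h₁; simp [h₁], h₂ T hT⟩
      · intro h
        -- The smallest group is `D` itself, and its average is defined only if `D` is nonempty.
        exact ⟨by simpa using (h [] (List.nil_sublist F)).1, fun T hT => (h T hT).2⟩

end Correctness

/-! ### Correctness of the solution check and of the answer set check -/

section Solutions

variable {K : Type} [Field K] [LinearOrder K] [IsStrictOrderedRing K]

/-- Among the instances of the grouped atom, those in `I` are always true, those in `J` never, and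
the free ones are true exactly if they belong to `T`. This links interpretations `M` to sublists
`T`. -/
theorem AggAtom.interp_eq_of_listing {l : AggAtom K} {B M : Finset (Atom K)}
    {H I J T : List (Atom K)} (hI : I.Nodup) (hH : H.toFinset = l.ext B)
    (hMB : M ⊆ B) (hIM : I.toFinset ⊆ M) (hJM : J.toFinset ∩ M = ∅) (hn : T.Nodup)
    (hT : T ⊆ H.filter fun a => l.s.matches a && !memAtom I a && !memAtom J a)
    (hTM : ∀ a ∈ H.filter fun a => l.s.matches a && !memAtom I a && !memAtom J a,
      a ∈ M ↔ a ∈ T) :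
    l.s.interp M =
      ((l.fixedVals I ++ T.map fun a => l.s.value a : List (Const K)) : Multiset (Const K)) := by
  have hmem : ∀ {a}, a ∈ H.filter (fun a => l.s.matches a && !memAtom I a && !memAtom J a) ↔
      a ∈ H ∧ l.s.matches a = true ∧ a ∉ I ∧ a ∉ J := by
    intro a
    simp only [List.mem_filter, Bool.and_eq_true, Bool.not_eq_true', ← Bool.not_eq_true,
      memAtom_iff]
    tauto
  have hval : (l.s.support M).val =
      (((I.filter fun a => l.s.matches a) ++ T : List (Atom K)) : Multiset (Atom K)) := by
    refine (Multiset.Nodup.ext (l.s.support M).nodup ?_).2 fun a => ?_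
    · rw [Multiset.coe_nodup, List.nodup_append']
      refine ⟨hI.filter _, hn, fun a ha hb => ?_⟩
      exact (hmem.1 (hT hb)).2.2.1 (List.mem_filter.1 ha).1
    · rw [Finset.mem_val, Intensional.mem_support, ← Intensional.matches_iff, Multiset.mem_coe,
        List.mem_append, List.mem_filter]
      constructor
      · rintro ⟨haM, hm⟩
        by_cases haI : a ∈ I
        · exact Or.inl ⟨haI, hm⟩
        · refine Or.inr ((hTM a (hmem.2 ⟨?_, hm, haI, fun haJ => ?_⟩)).1 haM)
          -- An instance of the grouped atom has its predicate and arity, so it lies in `H(l)` once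
          -- it lies in `B`.
          · rw [← List.mem_toFinset, hH, AggAtom.ext, Finset.mem_filter]
            obtain ⟨γ, rfl⟩ := (l.s.matches_iff a).1 hm
            exact ⟨hMB haM, rfl, by simp [Intensional.inst]⟩
          · have : a ∈ J.toFinset ∩ M := Finset.mem_inter.2 ⟨List.mem_toFinset.2 haJ, haM⟩
            simp [hJM] at this
      · rintro (⟨haI, hm⟩ | haT)
        · exact ⟨hIM (List.mem_toFinset.2 haI), hm⟩
        · exact ⟨(hTM a (hT haT)).2 haT, (hmem.1 (hT haT)).2.1⟩
  rw [Intensional.interp_eq, hval, Multiset.map_coe, List.map_append, AggAtom.fixedVals]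
  congr 2
  · exact List.map_congr_left fun a ha => (l.s.value_eq_proj (List.mem_filter.1 ha).2).symm
  · exact List.map_congr_left fun a ha => (l.s.value_eq_proj (hmem.1 (hT ha)).2.1).symm

theorem AggAtom.solutionCheck_iff {l : AggAtom K} (hl : l.Tractable) {B : Finset (Atom K)}
    {H I J : List (Atom K)} (hHn : H.Nodup) (hIn : I.Nodup) (hH : H.toFinset = l.ext B)
    (hI : I ⊆ H) (hJ : J ⊆ H) (hIJ : List.Disjoint I J) :
    l.solutionCheck H I J = true ↔ l.IsSolution B I.toFinset J.toFinset := by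
  rw [AggAtom.solutionCheck, groupCheck_iff hl, AggAtom.freeVals, forall_sublist_map]
  have hHB : ∀ a ∈ H, a ∈ B := fun a ha => by
    have : a ∈ l.ext B := by rw [← hH]; simpa using ha
    exact (Finset.mem_filter.1 this).1
  have hsub : ∀ L : List (Atom K), L ⊆ H → L.toFinset ⊆ l.ext B := fun L hL a ha => by
    rw [← hH, List.mem_toFinset]; exact hL (List.mem_toFinset.1 ha)
  constructor
  · intro h
    refine ⟨hsub I hI, hsub J hJ, List.disjoint_toFinset_iff_disjoint.2 hIJ,
      fun M hM hIM hJM => ?_⟩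
    have hs : ((H.filter fun a => l.s.matches a && !memAtom I a && !memAtom J a).filter
      fun a => decide (a ∈ M)).Sublist _ := List.filter_sublist
    have := h _ hs
    rwa [← AggAtom.interp_eq_of_listing hIn hH hM hIM hJM ((hHn.filter _).filter _) hs.subset
      (fun a ha => by rw [List.mem_filter, decide_eq_true_eq]; exact (and_iff_right ha).symm)]
        at this
  · rintro ⟨-, -, -, h⟩ T hT
    have hmem : ∀ {a}, a ∈ H.filter (fun a => l.s.matches a && !memAtom I a && !memAtom J a) →
        a ∈ H ∧ a ∉ I ∧ a ∉ J := by
      intro a ha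
      simp only [List.mem_filter, Bool.and_eq_true, Bool.not_eq_true', ← Bool.not_eq_true,
        memAtom_iff] at ha
      exact ⟨ha.1, ha.2.1.2, ha.2.2⟩
    -- The sublist `T` is realised by the interpretation `I ∪ T`.
    have hMB : (I ++ T).toFinset ⊆ B := fun a ha => by
      rw [List.mem_toFinset, List.mem_append] at ha
      rcases ha with ha | ha
      · exact hHB a (hI ha)
      · exact hHB a (hmem (hT.subset ha)).1
    have hIM : I.toFinset ⊆ (I ++ T).toFinset := fun a ha => by
      rw [List.mem_toFinset] at ha ⊢
      exact List.mem_append_left _ ha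
    have hJM : J.toFinset ∩ (I ++ T).toFinset = ∅ := by
      refine Finset.eq_empty_of_forall_notMem fun a ha => ?_
      rw [Finset.mem_inter, List.mem_toFinset, List.mem_toFinset, List.mem_append] at ha
      rcases ha with ⟨ha, hb | hb⟩
      · exact hIJ hb ha
      · exact (hmem (hT.subset hb)).2.2 ha
    have := h _ hMB hIM hJM
    rwa [AggAtom.Sat, AggAtom.interp_eq_of_listing hIn hH hMB hIM hJM
      (hT.nodup (hHn.filter _)) hT.subset (fun a ha => by
        rw [List.mem_toFinset, List.mem_append]
        exact or_iff_right (hmem ha).2.1)] at this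

theorem AggAtom.mem_extList {l : AggAtom K} {B : List (Atom K)} {a : Atom K} :
    a ∈ l.extList B ↔ a ∈ l.ext B.toFinset := by
  simp [AggAtom.extList, AggAtom.ext]

theorem AggAtom.condCheck_iff {l : AggAtom K} (hl : l.Tractable) {B I M : List (Atom K)}
    (hB : B.Nodup) :
    l.condCheck B I M = true ↔ l.CondSat B.toFinset I.toFinset M.toFinset := by
  have hn : (l.extList B).Nodup := hB.filter _
  rw [AggAtom.condCheck, AggAtom.solutionCheck_iff hl (B := B.toFinset) hn (hn.filter _)
    (by ext a; rw [List.mem_toFinset, AggAtom.mem_extList])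
    (List.filter_sublist.subset) (List.filter_sublist.subset), AggAtom.CondSat]
  · have h₁ : ((l.extList B).filter fun a => memAtom I a && memAtom M a).toFinset =
        I.toFinset ∩ M.toFinset ∩ l.ext B.toFinset := by
      ext a
      simp only [List.mem_toFinset, List.mem_filter, AggAtom.mem_extList, Bool.and_eq_true,
        memAtom_iff, Finset.mem_inter]
      tauto
    have h₂ : ((l.extList B).filter fun a => !memAtom M a).toFinset =
        l.ext B.toFinset \ M.toFinset := by
      ext a
      simp only [List.mem_toFinset, List.mem_filter, AggAtom.mem_extList, Bool.not_eq_true',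
        ← Bool.not_eq_true, memAtom_iff, Finset.mem_sdiff]
    rw [h₁, h₂]
  · intro a ha hb
    simp only [List.mem_filter, Bool.and_eq_true, Bool.not_eq_true', ← Bool.not_eq_true,
      memAtom_iff] at ha hb
    exact hb.2 ha.2.2

/-! Least fixpoints -/

/-- The iterates from `∅` increase inside `B`, so they become stationary within `|B|` steps. By
monotonicity they stay below every fixpoint. -/
theorem isLeast_fixpoint_iff {α : Type} [DecidableEq α] {f : Finset α → Finset α} (hf : Monotone f)
    {B : Finset α} (hB : ∀ I, f I ⊆ B) {n : ℕ} (hn : B.card ≤ n) (M : Finset α) :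
    IsLeast {I | I ⊆ B ∧ f I = I} M ↔ f^[n] ∅ = M := by
  have hsub : ∀ k, f^[k] ∅ ⊆ B := by
    rintro (_ | k)
    · simp
    · rw [Function.iterate_succ_apply']; exact hB _
  have hle : ∀ k, f^[k] ∅ ⊆ f (f^[k] ∅) := by
    intro k
    induction k with
    | zero => simp
    | succ k ih => rw [Function.iterate_succ_apply']; exact hf ih
  -- Until the iteration is stationary, each step adds an element.
  have hk : ∀ k, k ≤ (f^[k] ∅).card ∨ f (f^[k] ∅) = f^[k] ∅ := by
    intro k
    induction k with
    | zero => simp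
    | succ k ih =>
      rw [Function.iterate_succ_apply']
      by_cases h : f (f^[k] ∅) = f^[k] ∅
      · right; rw [h, h]
      · left
        have h₁ := ih.resolve_right h
        have h₂ := Finset.card_lt_card ((hle k).ssubset_of_ne (Ne.symm h))
        omega
  have hfix : f (f^[n] ∅) = f^[n] ∅ := by
    rcases hk n with h | h
    -- An iterate with at least `n ≥ |B|` elements is all of `B`, so it cannot grow further.
    · have : f^[n] ∅ = B := Finset.eq_of_subset_of_card_le (hsub n) (hn.trans h)
      exact Finset.Subset.antisymm (by rw [this]; exact hB _) (hle n)
    · exact h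
  have hleast : IsLeast {I | I ⊆ B ∧ f I = I} (f^[n] ∅) := by
    refine ⟨⟨hsub n, hfix⟩, fun I hI => ?_⟩
    have : ∀ k, f^[k] ∅ ⊆ I := by
      intro k
      induction k with
      | zero => simp
      | succ k ih => rw [Function.iterate_succ_apply', ← hI.2]; exact hf ih
    exact this n
  exact ⟨fun h => hleast.unique h, fun h => h ▸ hleast⟩

/-- A larger first component leaves fewer interpretations to check. Disjointness survives because
that component is cut down to `M`, while the second one avoids `M`. -/
theorem AggAtom.CondSat.mono {l : AggAtom K} {B I I' M : Finset (Atom K)} (h : I ⊆ I')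
    (hl : l.CondSat B I M) : l.CondSat B I' M := by
  obtain ⟨-, h₂, -, h₄⟩ := hl
  refine ⟨Finset.inter_subset_right, h₂, ?_, fun N hN h₁ h₃ => h₄ N hN ?_ h₃⟩
  · rw [Finset.disjoint_left]
    intro a ha hb
    rw [Finset.mem_inter, Finset.mem_inter] at ha
    exact (Finset.mem_sdiff.1 hb).2 ha.1.2
  · intro a ha
    rw [Finset.mem_inter, Finset.mem_inter] at ha
    exact h₁ (by
      rw [Finset.mem_inter, Finset.mem_inter]
      exact ⟨⟨h ha.1.1, ha.1.2⟩, ha.2⟩)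

/-! ### The consequence operator and its computation on lists -/

theorem mem_consequence {B M I : Finset (Atom K)} {P : List (Rule K)} {a : Atom K} :
    a ∈ consequence B P M I ↔ ∃ r ∈ P, (∀ b ∈ r.neg, b ∉ M) ∧ (∀ b ∈ r.pos, b ∈ I) ∧
      (∀ l ∈ r.aggs, l.CondSat B I M) ∧ r.head = a := by
  simp only [consequence, reduct, List.mem_toFinset, List.mem_map, List.mem_filter,
    decide_eq_true_eq]
  constructor
  · rintro ⟨_, ⟨⟨r, ⟨hr, hn⟩, rfl⟩, hp, ha⟩, rfl⟩
    exact ⟨r, hr, hn, hp, ha, rfl⟩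
  · rintro ⟨r, hr, hn, hp, ha, rfl⟩
    exact ⟨_, ⟨⟨r, ⟨hr, hn⟩, rfl⟩, hp, ha⟩, rfl⟩

theorem consequence_mono (B M : Finset (Atom K)) (P : List (Rule K)) :
    Monotone (consequence B P M) := by
  intro I I' h a ha
  obtain ⟨r, hr, hn, hp, hl, e⟩ := mem_consequence.1 ha
  exact mem_consequence.2 ⟨r, hr, hn, fun b hb => h (hp b hb), fun l hl' => (hl l hl').mono h, e⟩

theorem Rule.fires_iff {r : Rule K} (hr : ∀ l ∈ r.aggs, l.Tractable) {B M I : List (Atom K)}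
    (hB : B.Nodup) :
    r.fires B M I = true ↔ (∀ b ∈ r.neg, b ∉ M.toFinset) ∧ (∀ b ∈ r.pos, b ∈ I.toFinset) ∧
      ∀ l ∈ r.aggs, l.CondSat B.toFinset I.toFinset M.toFinset := by
  simp only [Rule.fires, Bool.and_eq_true, List.all_eq_true, Bool.not_eq_true',
    ← Bool.not_eq_true, memAtom_iff, List.mem_toFinset, and_assoc]
  refine and_congr_right fun _ => and_congr_right fun _ => forall₂_congr fun l hl => ?_
  exact AggAtom.condCheck_iff (hr l hl) hB

variable {B : List (Atom K)} {P : List (Rule K)}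

theorem consequenceList_toFinset (hB : B.Nodup) (hP : ∀ r ∈ P, r.head ∈ B)
    (ht : ∀ r ∈ P, ∀ l ∈ r.aggs, l.Tractable) (M I : List (Atom K)) :
    (consequenceList B P M I).toFinset = consequence B.toFinset P M.toFinset I.toFinset := by
  ext a
  rw [mem_consequence, List.mem_toFinset, consequenceList, List.mem_filter]
  simp only [List.any_eq_true, Bool.and_eq_true, Atom.same_iff]
  constructor
  · rintro ⟨-, r, hr, rfl, hf⟩
    obtain ⟨h₁, h₂, h₃⟩ := (Rule.fires_iff (ht r hr) hB).1 hf
    exact ⟨r, hr, h₁, h₂, h₃, rfl⟩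
  · rintro ⟨r, hr, h₁, h₂, h₃, rfl⟩
    exact ⟨hP r hr, r, hr, rfl, (Rule.fires_iff (ht r hr) hB).2 ⟨h₁, h₂, h₃⟩⟩

theorem leastModel_toFinset (hB : B.Nodup) (hP : ∀ r ∈ P, r.head ∈ B)
    (ht : ∀ r ∈ P, ∀ l ∈ r.aggs, l.Tractable) (M : List (Atom K)) :
    (leastModel B P M).toFinset = (consequence B.toFinset P M.toFinset)^[B.length] ∅ := by
  have h : ∀ (L I : List (Atom K)), (L.foldl (fun I _ => consequenceList B P M I) I).toFinset =
      (consequence B.toFinset P M.toFinset)^[L.length] I.toFinset := by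
    intro L
    induction L with
    | nil => intro I; rfl
    | cons a L ih =>
      intro I
      rw [List.foldl_cons, ih, consequenceList_toFinset hB hP ht, List.length_cons,
        Function.iterate_succ_apply]
  exact h B []

theorem answerSetCheck_iff (hB : B.Nodup) (hP : ∀ r ∈ P, r.head ∈ B)
    (ht : ∀ r ∈ P, ∀ l ∈ r.aggs, l.Tractable) (M : List (Atom K)) :
    answerSetCheck B P M = true ↔ IsAnswerSet B.toFinset P M.toFinset := by
  rw [IsAnswerSet, isLeast_fixpoint_iff (consequence_mono _ _ P) (fun I a ha => by
    obtain ⟨r, hr, -, -, -, rfl⟩ := mem_consequence.1 ha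
    exact List.mem_toFinset.2 (hP r hr)) (List.toFinset_card_le B), ← leastModel_toFinset hB hP ht]
  simp only [answerSetCheck, Bool.and_eq_true, List.all_eq_true, memAtom_iff, Finset.ext_iff,
    List.mem_toFinset]
  exact ⟨fun h a => ⟨h.1 a, h.2 a⟩, fun h => ⟨fun a => (h a).1, fun a => (h a).2⟩⟩

/-- The tree that selects the elements of `M` from a list. -/
def selector (M : Finset (Atom K)) (B : List (Atom K)) : Data K :=
  encList (fun a => Data.ofBool (decide (a ∈ M))) B

theorem selectAtoms_selector {M : Finset (Atom K)} (h : M ⊆ B.toFinset) :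
    (selectAtoms B (selector M B)).toFinset = M := by
  have key : ∀ (B acc : List (Atom K)) (a : Atom K),
      a ∈ (B.foldl (fun z a => (z.1.tl, bif z.1.hd.truthy then a :: z.2 else z.2))
        (selector M B, acc)).2 ↔ a ∈ acc ∨ a ∈ B ∧ a ∈ M := by
    intro B
    induction B with
    | nil => simp
    | cons b B ih =>
      intro acc a
      have e : selector M (b :: B) = .cons (Data.ofBool (decide (b ∈ M))) (selector M B) := rfl
      rw [List.foldl_cons, e]
      refine (ih _ a).trans ?_
      by_cases hb : b ∈ M
      · simp only [Data.hd, hb, decide_true, Data.ofBool, Data.truthy, cond_true, List.mem_cons]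
        constructor
        · rintro ((rfl | h) | h)
          · exact Or.inr ⟨Or.inl rfl, hb⟩
          · exact Or.inl h
          · exact Or.inr ⟨Or.inr h.1, h.2⟩
        · rintro (h | ⟨rfl | h, h'⟩)
          · exact Or.inl (Or.inr h)
          · exact Or.inl (Or.inl rfl)
          · exact Or.inr ⟨h, h'⟩
      · simp only [Data.hd, hb, decide_false, Data.ofBool, Data.truthy, cond_false, List.mem_cons]
        constructor
        · rintro (h | h)
          · exact Or.inl h
          · exact Or.inr ⟨Or.inr h.1, h.2⟩
        · rintro (h | ⟨rfl | h, h'⟩)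
          · exact Or.inl h
          · exact absurd h' hb
          · exact Or.inr ⟨h, h'⟩
  ext a
  rw [List.mem_toFinset, selectAtoms, key]
  simp only [List.not_mem_nil, false_or, and_iff_right_iff_imp]
  exact fun ha => List.mem_toFinset.1 (h ha)

end Solutions

/-! ### The two cost models and the decision problems -/

section Problems

open TreeCode

/-- A subadditive bound for the bit length of rational numbers. -/
def ratMag (x : ℚ) : ℕ := max (Nat.size x.num.natAbs) (Nat.size x.den) + 1

/-- Over the common denominator, the lengths of the factors add up and the sum of the two numerators
costs one carry bit. The `+ 1` in each `ratMag` pays for that bit. -/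
theorem ratMag_add (x y : ℚ) : ratMag (x + y) ≤ ratMag x + ratMag y := by
  set a := max (Nat.size x.num.natAbs) (Nat.size x.den) with ha
  set b := max (Nat.size y.num.natAbs) (Nat.size y.den) with hb
  have hx₁ : x.num.natAbs < 2 ^ a := Nat.size_le.1 (le_max_left _ _)
  have hx₂ : x.den < 2 ^ a := Nat.size_le.1 (le_max_right _ _)
  have hy₁ : y.num.natAbs < 2 ^ b := Nat.size_le.1 (le_max_left _ _)
  have hy₂ : y.den < 2 ^ b := Nat.size_le.1 (le_max_right _ _)
  have hd : (x + y).den ≤ x.den * y.den :=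
    Nat.le_of_dvd (Nat.mul_pos x.den_pos y.den_pos) (Rat.add_den_dvd x y)
  have hnum : (x + y).num.natAbs ≤ x.num.natAbs * y.den + x.den * y.num.natAbs := by
    have h := congrArg Int.natAbs (Rat.add_num_den' x y)
    simp only [Int.natAbs_mul, Int.natAbs_natCast] at h
    have h₁ : (x.num * y.den + y.num * x.den).natAbs ≤
        x.num.natAbs * y.den + x.den * y.num.natAbs := by
      refine (Int.natAbs_add_le _ _).trans ?_
      simp only [Int.natAbs_mul, Int.natAbs_natCast]
      rw [mul_comm y.num.natAbs]
    -- Reduction to lowest terms does not enlarge the numerator, because the reduced denominator is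
    -- at most `x.den * y.den`.
    refine Nat.le_of_mul_le_mul_right ?_ (Nat.mul_pos x.den_pos y.den_pos)
    rw [← mul_assoc, h]
    exact Nat.mul_le_mul h₁ hd
  have hp : ∀ {u v : ℕ}, u < 2 ^ a → v < 2 ^ b → u * v < 2 ^ (a + b) := fun hu hv => by
    rw [pow_add]; exact Nat.mul_lt_mul'' hu hv
  have h₁ : Nat.size (x + y).num.natAbs ≤ a + b + 1 := by
    rw [Nat.size_le, pow_succ]
    have := hp hx₁ hy₂
    have := hp hx₂ hy₁
    omega
  have h₂ : Nat.size (x + y).den ≤ a + b + 1 := by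
    rw [Nat.size_le, pow_succ]
    have := hp hx₂ hy₂
    omega
  simp only [ratMag, ← ha, ← hb]
  omega

theorem ratMag_neg (x : ℚ) : ratMag (-x) = ratMag x := by
  simp [ratMag]

instance : CostModel ℚ where
  weight := bits
  mag := ratMag
  weight_le x := by simp only [bits, ratMag]; omega
  mag_add := ratMag_add
  mag_sub x y := by
    rw [sub_eq_add_neg, ← ratMag_neg y]; exact ratMag_add x (-y)

/-- With magnitude `0`, `vol` counts only the nodes of a tree, as the unit-cost model requires. -/
instance : CostModel ℝ where
  weight := unitCost
  mag _ := 0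
  weight_le _ := le_rfl
  mag_add _ _ := le_rfl
  mag_sub _ _ := le_rfl

theorem Data.vol_le_size (d : Data ℚ) : d.vol ≤ 2 * d.size := by
  induction d with
  | nil => simp [Data.vol, Data.size]
  | num x =>
    have : CostModel.mag x ≤ bits x + 1 := by
      show ratMag x ≤ _
      simp only [bits, ratMag]; omega
    simp only [Data.vol, Data.size]; omega
  | cons a b h₁ h₂ => simp only [Data.vol, Data.size]; omega

/-- A polynomial-time Boolean function yields a decision procedure. -/
theorem PolyTime.answers {K α : Type} [Field K] [LinearOrder K] [CostModel K] [TreeCode K α]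
    {f : α → Bool} (hf : PolyTime K f) :
    ∃ (c : Cmd) (p : Polynomial ℕ), ∀ x : α,
      Answers CostModel.weight c (code x : Data K) (p.eval (code x : Data K).vol) (f x = true) := by
  obtain ⟨p, -, hc⟩ := hf
  obtain ⟨c, hc⟩ := hc 0
  refine ⟨.seq c (.assign 1 (.var 0)), p + 2, fun x => ?_⟩
  obtain ⟨s, t, e, r, -, b⟩ := hc (inputStore (code x)) x rfl
  refine ⟨_, _, .seq e (.assign ..), ?_, ?_⟩
  · simp only [Expr.cost, Polynomial.eval_add, Polynomial.eval_ofNat]; omega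
  · rw [Function.update_self, Expr.eval, r]
    exact code_bool_ne_nil _

theorem inP_of_polyTime {α β : Type} [TreeCode ℚ β] {f : β → Bool} (hf : PolyTime ℚ f)
    (g : α → β) {enc : α → Data ℚ} (he : ∀ x, enc x = code (g x)) {L : α → Prop}
    (hL : ∀ x, L x ↔ f (g x) = true) : InP enc L := by
  obtain ⟨c, p, h⟩ := hf.answers
  refine ⟨c, p.comp (2 * Polynomial.X), fun x => ?_⟩
  obtain ⟨s, t, h₁, h₂, h₃⟩ := h (g x)
  rw [← he] at h₁ h₂
  refine ⟨s, t, h₁, h₂.trans ?_, h₃.trans (hL x).symm⟩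
  simpa using eval_mono_nat p (Data.vol_le_size (enc x))

/-! ### The decision problems over the rationals -/

theorem SolutionInstance.yes_iff {K : Type} [Field K] [LinearOrder K] [IsStrictOrderedRing K]
    (x : SolutionInstance K) (hx : x.l.Tractable) :
    x.Yes ↔ x.l.solutionCheck x.H x.I x.J = true :=
  (AggAtom.solutionCheck_iff hx x.H_nodup x.I_nodup x.H_eq x.I_sub x.J_sub x.disj).symm

theorem solution_inP :
    InP (fun x : {x : SolutionInstance ℚ // x.l.Tractable} => x.1.enc) (fun x => x.1.Yes) :=
  inP_of_polyTime (β := AggAtom ℚ × List (Atom ℚ) × List (Atom ℚ) × List (Atom ℚ))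
    (f := fun y => y.1.solutionCheck y.2.1 y.2.2.1 y.2.2.2) (by fun_prop)
    (fun x : {x : SolutionInstance ℚ // x.l.Tractable} => (x.1.l, x.1.H, x.1.I, x.1.J))
    (fun _ => rfl) fun x => x.1.yes_iff x.2

theorem answerSet_inP :
    InP (fun x : {x : CheckInstance ℚ // x.P.Tractable} => x.1.enc) (fun x => x.1.Yes) :=
  inP_of_polyTime (β := (List (Atom ℚ) × List (Rule ℚ)) × List (Atom ℚ))
    (f := fun y => answerSetCheck y.1.1 y.1.2 y.2) (by fun_prop)
    (fun x : {x : CheckInstance ℚ // x.P.Tractable} => ((x.1.P.base, x.1.P.rules), x.1.M))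
    (fun _ => rfl)
    fun x => (answerSetCheck_iff x.1.P.base_nodup x.1.P.head_mem x.2 x.1.M).symm

theorem size_selector (M : Finset (Atom ℚ)) (B : List (Atom ℚ)) :
    (selector M B).size ≤ 4 * (encList Atom.enc B).size := by
  induction B with
  | nil => simp [selector, encList, Data.size]
  | cons a B ih =>
    have h : (Data.ofBool (decide (a ∈ M)) : Data ℚ).size ≤ 3 := by
      cases decide (a ∈ M) <;> simp [Data.ofBool, Data.size]
    simp only [selector, encList, List.foldr_cons, Data.size] at ih ⊢
    omega

/-- Every tree selects some part of the base, so certificates need no test for well-formedness; for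
completeness the certificate is `selector M`. -/
theorem hasAnswerSet_inNP :
    InNP (fun P : {P : Program ℚ // P.Tractable} => P.1.enc) (fun P => P.1.HasAnswerSet) := by
  have hf : PolyTime ℚ fun y : (List (Atom ℚ) × List (Rule ℚ)) × Data ℚ =>
      answerSetCheck y.1.1 y.1.2 (selectAtoms y.1.1 y.2) := by fun_prop
  obtain ⟨c, p, h⟩ := hf.answers
  have hq : ∀ n, (4 * Polynomial.X : Polynomial ℕ).eval n = 4 * n := fun n => by simp
  -- A certificate of size at most `4 * n` and an input of size `n` form a pair of size at most `1 +
  -- 5 * n`; `vol` is at most twice that.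
  refine ⟨c, p.comp (2 + 10 * Polynomial.X), 4 * Polynomial.X, fun P y =>
    answerSetCheck P.1.base P.1.rules (selectAtoms P.1.base y) = true, fun P y hy => ?_,
    fun P => ⟨?_, ?_⟩⟩
  · obtain ⟨s, t, h₁, h₂, h₃⟩ := h ((P.1.base, P.1.rules), y)
    refine ⟨s, t, h₁, h₂.trans ?_, h₃⟩
    have hv := Data.vol_le_size (.cons P.1.enc y)
    rw [hq] at hy
    beta_reduce at hy
    have : (Data.cons P.1.enc y).vol ≤ 2 + 10 * P.1.enc.size := by
      simp only [Data.size] at hv; omega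
    rw [Polynomial.eval_comp]
    refine (eval_mono_nat p this).trans_eq ?_
    simp
  · rintro ⟨M, hM⟩
    refine ⟨selector M P.1.base, ?_, ?_⟩
    · have := size_selector M P.1.base
      simp only [hq, Program.enc, Data.size]
      omega
    · beta_reduce
      rw [answerSetCheck_iff P.1.base_nodup P.1.head_mem P.2, selectAtoms_selector hM.1.1]
      exact hM
  · rintro ⟨y, -, hy⟩
    exact ⟨_, (answerSetCheck_iff P.1.base_nodup P.1.head_mem P.2 _).1 hy⟩

/-! Real numbers with unit cost -/

theorem vol_num_real (x : ℝ) : (Data.num x).vol = 1 := rfl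

theorem vol_const_le (c : Const ℝ) : (code c : Data ℝ).vol ≤ 3 := by
  cases c
  · exact (vol_num_real _).le.trans (by norm_num)
  · exact le_rfl

theorem vol_term_le (t : Term ℝ) : (code t : Data ℝ).vol ≤ 5 := by
  cases t with
  | const c =>
    have := vol_const_le c
    show 1 + 1 + (code c : Data ℝ).vol ≤ 5
    omega
  | var i => exact (show 1 + 1 + 1 ≤ 5 by norm_num)

theorem vol_atom_le (a : Atom ℝ) : (code a : Data ℝ).vol ≤ 3 + 4 * a.args.length := by
  have := vol_le_of_forall_le (K := ℝ) (l := a.args) fun c _ => vol_const_le c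
  show 1 + 1 + (code a.args : Data ℝ).vol ≤ _
  omega

theorem vol_aggAtom_le (l : AggAtom ℝ) : (code l : Data ℝ).vol ≤ 13 + 6 * l.s.args.length := by
  have h := vol_le_of_forall_le (K := ℝ) (l := l.s.args) fun t _ => vol_term_le t
  have h₁ : (l.fn.enc : Data ℝ).vol = 1 := by cases l.fn <;> rfl
  have h₂ : (l.op.enc : Data ℝ).vol = 1 := by cases l.op <;> rfl
  have h₃ : (l.s.kind.enc : Data ℝ).vol = 1 := by cases l.s.kind <;> rfl
  show 1 + (l.fn.enc : Data ℝ).vol + (1 + (l.op.enc : Data ℝ).vol + (1 + 1 +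
    (1 + (l.s.kind.enc : Data ℝ).vol + (1 + 1 + (1 + 1 + (code l.s.args : Data ℝ).vol))))) ≤ _
  omega

/-- If `H(l)` is nonempty, its size is at least the arity plus one, so it also bounds the aggregate
atom itself. The atom contributes `6` to the factor `18` and the three lists `4` each. -/
theorem SolutionInstance.vol_enc_le (x : SolutionInstance ℝ) (hH : x.H ≠ []) :
    x.enc.vol ≤ 19 + 18 * x.extSize := by
  set k := x.l.s.args.length with hk
  set h := x.H.length with hh
  have hpos : 1 ≤ h := List.length_pos_iff.2 hH
  have hcard : (x.l.ext x.B).card = h := by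
    rw [← x.H_eq, List.toFinset_card_of_nodup x.H_nodup]
  have hatom : ∀ a ∈ x.H, (code a : Data ℝ).vol ≤ 3 + 4 * k := by
    intro a ha
    have : a ∈ x.l.ext x.B := by rw [← x.H_eq]; simpa using ha
    rw [hk, ← (Finset.mem_filter.1 this).2.2]
    exact vol_atom_le a
  have hlist : ∀ L : List (Atom ℝ), L.Nodup → L ⊆ x.H →
      (code L : Data ℝ).vol ≤ 1 + 4 * ((k + 1) * h) := by
    intro L hn hL
    have h₁ := vol_le_of_forall_le (K := ℝ) (l := L) fun a ha => hatom a (hL ha)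
    have h₂ : L.length ≤ h := (hn.subperm hL).length_le
    have h₃ := Nat.mul_le_mul_right (1 + (3 + 4 * k)) h₂
    have h₄ : h * (1 + (3 + 4 * k)) = 4 * ((k + 1) * h) := by ring
    omega
  have h₁ := hlist x.H x.H_nodup (List.Subset.refl _)
  have h₂ := hlist x.I x.I_nodup x.I_sub
  have h₃ := hlist x.J x.J_nodup x.J_sub
  have h₄ := vol_aggAtom_le x.l
  have h₅ : k + 1 ≤ (k + 1) * h := Nat.le_mul_of_pos_right _ hpos
  rw [SolutionInstance.extSize, hcard, ← hk]
  show 1 + (code x.l : Data ℝ).vol + (1 + (code x.H : Data ℝ).vol +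
    (1 + (code x.I : Data ℝ).vol + (code x.J : Data ℝ).vol)) ≤ _
  omega

/-- If `H(l)` is empty, then only the function, the relation and the number of `l` are read. -/
theorem solution_polyTimeDecidable :
    PolyTimeDecidable (K := ℝ) unitCost
      (fun x : {x : SolutionInstance ℝ // x.l.Tractable} => x.1.enc)
      (fun x => x.1.extSize) (fun x => x.1.Yes) := by
  have hf : PolyTime ℝ fun y : AggAtom ℝ × List (Atom ℝ) × List (Atom ℝ) × List (Atom ℝ) =>
      y.1.solutionCheck y.2.1 y.2.2.1 y.2.2.2 := by fun_prop
  have hg : PolyTime ℝ fun y : AggFn × RelOp × ℝ × List (Const ℝ) × List (Const ℝ) =>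
      groupCheck y.1 y.2.1 y.2.2.1 y.2.2.2.1 y.2.2.2.2 := by fun_prop
  obtain ⟨c, p, hc⟩ := hf.answers
  obtain ⟨d, q, hd⟩ := hg.answers
  -- For empty `H(l)`, the input is replaced by the tuple of the function, the relation, the number
  -- and two empty lists of values. Its volume is `9`, whatever the arity.
  let e : Expr := .cons (.path (.var 0) [false, false]) (.cons (.path (.var 0) [false, true, false])
    (.cons (.path (.var 0) [false, true, true, false]) (.cons .nil .nil)))
  refine ⟨.ite (.path (.var 0) [true, false]) c (.seq (.assign 0 e) d),
    p.comp (19 + 18 * Polynomial.X) + Polynomial.C (q.eval 9) + 40, fun x => ?_⟩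
  obtain ⟨x, hx⟩ := x
  have htest : (Expr.path (.var 0) [true, false]).eval (inputStore x.enc) = code x.H := rfl
  by_cases hH : x.H = []
  · have hI : x.I = [] := List.eq_nil_iff_forall_not_mem.2 fun a ha => by
      simpa [hH] using x.I_sub ha
    have hJ : x.J = [] := List.eq_nil_iff_forall_not_mem.2 fun a ha => by
      simpa [hH] using x.J_sub ha
    obtain ⟨s, t, h₁, h₂, h₃⟩ := hd (x.l.fn, x.l.op, x.l.v, [], [])
    have hv : (code (x.l.fn, x.l.op, x.l.v, ([] : List (Const ℝ)), ([] : List (Const ℝ))) :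
        Data ℝ).vol = 9 := by
      have e₁ : (x.l.fn.enc : Data ℝ).vol = 1 := by cases x.l.fn <;> rfl
      have e₂ : (x.l.op.enc : Data ℝ).vol = 1 := by cases x.l.op <;> rfl
      show 1 + (x.l.fn.enc : Data ℝ).vol + (1 + (x.l.op.enc : Data ℝ).vol + (1 + 1 +
        (1 + 1 + 1))) = 9
      omega
    have hs : Function.update (inputStore x.enc) 0 (e.eval (inputStore x.enc)) =
        inputStore (code (x.l.fn, x.l.op, x.l.v, ([] : List (Const ℝ)), ([] : List (Const ℝ)))) := by
      funext i
      by_cases hi : i = 0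
      · subst hi; rfl
      · simp [inputStore, hi]
    rw [← hs] at h₁
    refine ⟨s, _, .iteFalse (by rw [htest, hH]; rfl) (.seq (.assign ..) h₁), ?_, ?_⟩
    · rw [hv] at h₂
      simp only [e, Expr.cost, Expr.cost_path, List.length_cons, List.length_nil,
        Polynomial.eval_add, Polynomial.eval_C, Polynomial.eval_ofNat]
      omega
    · refine h₃.trans (Iff.trans ?_ (x.yes_iff hx).symm)
      rw [hH, hI, hJ]
      rfl
  · obtain ⟨s, t, h₁, h₂, h₃⟩ := hc (x.l, x.H, x.I, x.J)
    refine ⟨s, _, .iteTrue ?_ h₁, ?_, h₃.trans (x.yes_iff hx).symm⟩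
    · rw [htest]
      obtain ⟨a, L, h⟩ := List.exists_cons_of_ne_nil hH
      rw [h]
      simp [code_cons]
    · have h₄ := h₂.trans (eval_mono_nat p (x.vol_enc_le hH))
      simp only [Expr.cost, Expr.cost_path, List.length_cons, List.length_nil, Polynomial.eval_add,
        Polynomial.eval_C, Polynomial.eval_ofNat, Polynomial.eval_comp, Polynomial.eval_mul,
        Polynomial.eval_X]
      omega

end Problems

end AggSol

theorem mainTheorem10 :
    -- Solution checking for real data, with unit-cost arithmetic, in time polynomial in `H(l)`.
    AggSol.PolyTimeDecidable (K := ℝ) AggSol.unitCost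
      (fun x : {x : AggSol.SolutionInstance ℝ // x.l.Tractable} => x.1.enc)
      (fun x => x.1.extSize) (fun x => x.1.Yes) ∧
    -- Solution checking for rational data is in P.
    AggSol.InP (fun x : {x : AggSol.SolutionInstance ℚ // x.l.Tractable} => x.1.enc)
      (fun x => x.1.Yes) ∧
    -- Answer set checking is in P.
    AggSol.InP (fun x : {x : AggSol.CheckInstance ℚ // x.P.Tractable} => x.1.enc)
      (fun x => x.1.Yes) ∧
    -- Answer set existence is in NP.
    AggSol.InNP (fun P : {P : AggSol.Program ℚ // P.Tractable} => P.1.enc)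
      (fun P => P.1.HasAnswerSet) :=
  ⟨AggSol.solution_polyTimeDecidable, AggSol.solution_inP, AggSol.answerSet_inP,
    AggSol.hasAnswerSet_inNP⟩
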